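/- **Setting.** In adapted coordinates, let $\mathcal Q\subseteq\mathbb R^n$ be open (the coordinate domain of the configuration space), let $\mathbb R^m$ be the control fibre, and let $f(q,v)\in\mathbb R^n$, $\rho(q)\in\mathbb R^{n\times m}$ (injective), a Riemannian metric $\mathrm g_{\mathcal Q}$ on $\mathcal Q$ and $\phi(q,v)\in\mathbb R$ be continuously differentiable for $q\in\mathcal Q$, $v\in\mathbb R^n$, with $\partial f/\partial v$ also continuously differentiable. Put $\mathrm g=\rho^\top\mathrm g_{\mathcal Q}\,\rho$ and let $q^0\in\mathcal Q$, $\dot q^0\in\mathbb R^n$. Let $T=Nh$ with $h>0$, $N\ge 1$. **Continuous conditions** for $q\in C^3([0,T],\mathcal Q)$, $\lambda\in C^2([0,T],(\mathbb R^n)^*)$, $u\in C^1([0,T],\mathbb R^m)$ and covectors $\mu,\nu$: on all of $[0,T]$ $$\ddot\lambda=\Big(\tfrac{\partial f}{\partial q}+\tfrac{\partial\rho}{\partial q}u\Big)^{\!\top}\!\lambda-\tfrac{d}{dt}\Big(\big(\tfrac{\partial f}{\partial\dot q}\big)^{\!\top}\lambda\Big)-\tfrac12\Big(\tfrac{\partial\mathrm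 g}{\partial q}(u,u)\Big)^{\!\top},\qquad \ddot q=f(q,\dot q)+\rho(q)u,\qquad \mathrm g(q)u=\rho(q)^\top\lambda,$$ with $q(0)=q^0$, $\dot q(0)=\dot q^0$, $\mu=-\dot\lambda(0)-\frac{\partial f}{\partial\dot q}(q(0),\dot q(0))^\top\lambda(0)$, $\nu=\lambda(0)$, $\dot\lambda(T)=\frac{\partial\phi}{\partial q}^\top+\frac{\partial f}{\partial\dot q}^\top\frac{\partial\phi}{\partial\dot q}^\top$ and $\lambda(T)=-\frac{\partial\phi}{\partial\dot q}^\top$, evaluated at $(q(T),\dot q(T))$. **Exact semi-discrete objective.** Let $y=(q,\lambda)$ and $$\tilde{\mathcal L}^{\mathcal E}(q,\lambda,v,v_\lambda,u)=v_\lambda^\top v+\lambda^\top(f(q,v)+\rho(q)u)-\tfrac12u^\top\mathrm g(q)u .$$ Let $D$ be an open set of triples $(a,b,w)\in\mathbb R^n\times\mathbb R^n\times C^1([0,h],\mathbb R^m)$ and $V$ an open set of curves in $C^1([0,h],\mathbb R^n)$. Assume that the exact discrete Lagrangian is well defined on $D$: for every $(a,b,w)\in D$ and all covectors $\lambda_a,\lambda_b$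 there is exactly one solution $(q,\lambda)$ on $[0,h]$ of the state and adjoint dynamics under the control $w$ with $q\in V$, $q(0)=a$, $q(h)=b$, $\lambda(0)=\lambda_a$, $\lambda(h)=\lambda_b$ (the state curve being the unique solution in $V$ of its own boundary value problem), and the state curve depends differentiably, in $C^1([0,h],\mathbb R^n)$, on $(a,b,w)$. For $(q_k,q_{k+1},u_{k,k+1})\in D$ write $y_{k,k+1}$ for this solution with $y_{k,k+1}(0)=y_k$, $y_{k,k+1}(h)=y_{k+1}$, and put $$\tilde{\mathcal L}^{\mathcal E,e}_d(y_k,y_{k+1},u_{k,k+1})=\int_0^h\tilde{\mathcal L}^{\mathcal E}(y_{k,k+1},\dot y_{k,k+1},u_{k,k+1})\,dt,$$ $v_0^{e,-}=\dot q_{0,1}(0)$, $v_N^{e,+}=\dot q_{N-1,N}(h)$ and $$\tilde{\mathcal J}^{\mathcal E,e}_d[y_d,u_d,\mu,\nu]=\phi(q_N,v_N^{e,+})+\lambda_N^\top v_N^{e,+}-\lambda_0^\top v_0^{e,-}+\mu^\top(q_0-q^0)+\nu^\top(v_0^{e,-}-\dot q^0)-\sum_{k=0}^{N-1}\tilde{\mathcal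 L}^{\mathcal E,e}_d(y_k,y_{k+1},u_{k,k+1}).$$ The variables are $y_d=(y_0,\dots,y_N)$, $u_d=(u_{0,1},\dots,u_{N-1,N})$ with $u_{k,k+1}\in C^1([0,h],\mathbb R^m)$, and $\mu,\nu$; always $(q_k,q_{k+1},u_{k,k+1})\in D$ for $k<N$. **Theorem.** 1. The velocities $\dot q_{k,k+1}(0)$ and $\dot q_{k,k+1}(h)$ are $-D_{\lambda_k}\tilde{\mathcal L}^{\mathcal E,e}_d$ and $D_{\lambda_{k+1}}\tilde{\mathcal L}^{\mathcal E,e}_d$. 2. If $N\ge3$, then $\delta\tilde{\mathcal J}^{\mathcal E,e}_d=0$ (vanishing Fréchet derivative in all variables) is equivalent to the following discrete optimality conditions, where $\tilde{\mathcal L}_k=\tilde{\mathcal L}^{\mathcal E,e}_d(y_k,y_{k+1},u_{k,k+1})$: $D_1\tilde{\mathcal L}_k+D_2\tilde{\mathcal L}_{k-1}=0$ for $2\le k\le N-2$; $D_3\tilde{\mathcal L}_k=0$ for $1\le k\le N-2$; $q_0=q^0$; $v_0^{e,-}=\dot q^0$; and $$\begin{aligned} &(\nu-\lambda_0)^\top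 D_{q_0}v_0^{e,-}+\mu^\top-D_{q_0}\tilde{\mathcal L}_0=0, &&(\nu-\lambda_0)^\top D_{y_1}v_0^{e,-}-(D_1\tilde{\mathcal L}_1+D_2\tilde{\mathcal L}_0)=0,\\ &(D_2\phi+\lambda_N^\top)D_{y_{N-1}}v_N^{e,+}-(D_2\tilde{\mathcal L}_{N-2}+D_1\tilde{\mathcal L}_{N-1})=0, &&(D_2\phi+\lambda_N^\top)D_{q_N}v_N^{e,+}+D_1\phi-D_{q_N}\tilde{\mathcal L}_{N-1}=0,\\ &(\nu-\lambda_0)^\top D_{u_{0,1}}v_0^{e,-}-D_3\tilde{\mathcal L}_0=0, &&(D_2\phi+\lambda_N^\top)D_{u_{N-1,N}}v_N^{e,+}-D_3\tilde{\mathcal L}_{N-1}=0, \end{aligned}$$ with $\phi$ differentiated at $(q_N,v_N^{e,+})$. 3. (Continuous to discrete.) If $(q,\lambda,u,\mu,\nu)$ satisfies the continuous conditions, and $y_k=(q(kh),\lambda(kh))$, $u_{k,k+1}=u(kh+\cdot)|_{[0,h]}$ satisfy $(q_k,q_{k+1},u_{k,k+1})\in D$ and $q(kh+\cdot)|_{[0,h]}\in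 V$ for all $k<N$, then $\delta\tilde{\mathcal J}^{\mathcal E,e}_d=0$ at $(y_d,u_d,\mu,\nu)$, and the appended equations $\lambda_0=\nu$, $\lambda_N=-\frac{\partial\phi}{\partial\dot q}(q_N,v_N^{e,+})^\top$ hold. 4. (Discrete to continuous.) If $\delta\tilde{\mathcal J}^{\mathcal E,e}_d=0$ at $(y_d,u_d,\mu,\nu)$ and the appended equations $\lambda_0=\nu$, $\lambda_N=-\frac{\partial\phi}{\partial\dot q}(q_N,v_N^{e,+})^\top$ hold, then the curves $q_{k,k+1}$, $\lambda_{k,k+1}$, $u_{k,k+1}$ concatenate to curves $q\in C^3$, $\lambda\in C^2$, $u\in C^1$ on $[0,T]$ which, with $\mu,\nu$, satisfy the continuous conditions; in particular $\mathrm g(q)u=\rho(q)^\top\lambda$ at every point of $[0,T]$. -/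

import Mathlib

open Set

noncomputable section

/-! ### The Banach space `C¹([0,h], F)` -/

section Curves

variable {F : Type*} [NormedAddCommGroup F]

/-- Extension by zero to `ℝ` of a function on `[0,h]`.  Only the values on `[0,h]` are ever used:
all derivatives below are derivatives within `[0,h]`. -/
def extendZero {h : ℝ} (x : C(Icc (0 : ℝ) h, F)) (s : ℝ) : F :=
  open Classical in if hs : s ∈ Icc (0 : ℝ) h then x ⟨s, hs⟩ else 0

theorem extendZero_add {h : ℝ} (x y : C(Icc (0 : ℝ) h, F)) :
    extendZero (x + y) = extendZero x + extendZero y := by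
  funext s
  by_cases hs : s ∈ Icc (0 : ℝ) h <;> simp [extendZero, hs]

theorem extendZero_smul [NormedSpace ℝ F] {h : ℝ} (c : ℝ) (x : C(Icc (0 : ℝ) h, F)) :
    extendZero (c • x) = c • extendZero x := by
  funext s
  by_cases hs : s ∈ Icc (0 : ℝ) h <;> simp [extendZero, hs]

theorem extendZero_zero {h : ℝ} : extendZero (0 : C(Icc (0 : ℝ) h, F)) = 0 := by
  funext s
  by_cases hs : s ∈ Icc (0 : ℝ) h <;> simp [extendZero, hs]

/-- Pairs `(x, x')` of continuous functions on `[0,h]` such that `x'` is the derivative of `x`. -/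
def c1Curves (h : ℝ) (F : Type*) [NormedAddCommGroup F] [NormedSpace ℝ F] :
    Submodule ℝ (C(Icc (0 : ℝ) h, F) × C(Icc (0 : ℝ) h, F)) where
  carrier := {c | ∀ s ∈ Icc (0 : ℝ) h,
    HasDerivWithinAt (extendZero c.1) (extendZero c.2 s) (Icc (0 : ℝ) h) s}
  add_mem' := by
    intro a b ha hb s hs
    have := (ha s hs).add (hb s hs)
    simpa [extendZero_add] using this
  zero_mem' := by
    intro s _
    simpa [extendZero_zero, Pi.zero_def] using hasDerivWithinAt_const s (Icc (0 : ℝ) h) (0 : F)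
  smul_mem' := by
    intro c a ha s hs
    have := (ha s hs).const_smul c
    simpa [extendZero_smul] using this

/-- `C¹([0,h], F)` with the norm `max (sup ‖x‖) (sup ‖x'‖)`. -/
def C1Curve (h : ℝ) (F : Type*) [NormedAddCommGroup F] [NormedSpace ℝ F] : Type _ :=
  ↥(c1Curves h F)

instance (h : ℝ) (F : Type*) [NormedAddCommGroup F] [NormedSpace ℝ F] :
    NormedAddCommGroup (C1Curve h F) :=
  inferInstanceAs (NormedAddCommGroup ↥(c1Curves h F))

instance (h : ℝ) (F : Type*) [NormedAddCommGroup F] [NormedSpace ℝ F] :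
    NormedSpace ℝ (C1Curve h F) :=
  inferInstanceAs (NormedSpace ℝ ↥(c1Curves h F))

/-- The value `x(s)`, `s ∈ [0,h]`. -/
def posAt [NormedSpace ℝ F] {h : ℝ} (c : C1Curve h F) (s : ℝ) : F := extendZero c.1.1 s

/-- The derivative `x'(s)`, `s ∈ [0,h]`. -/
def velAt [NormedSpace ℝ F] {h : ℝ} (c : C1Curve h F) (s : ℝ) : F := extendZero c.1.2 s

theorem hasDerivWithinAt_posAt [NormedSpace ℝ F] {h : ℝ} (c : C1Curve h F) {s : ℝ} (hs : s ∈ Icc (0 : ℝ) h) :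
    HasDerivWithinAt (posAt c) (velAt c s) (Icc (0 : ℝ) h) s :=
  c.2 s hs

end Curves

/-! ### The optimal control problem -/

/-- Covectors (row vectors `λᵀ`); the pairing `λᵀ v` is `l v`, and `(Aᵀ λ)ᵀ = λᵀ A` is
`l.comp A`. -/
abbrev Covec (E : Type*) [NormedAddCommGroup E] [NormedSpace ℝ E] : Type _ := E →L[ℝ] ℝ

/-- The data of the optimal control problem, in adapted coordinates:
minimise `φ(q(T), q̇(T)) + ∫₀ᵀ ½ uᵀ g(q) u dt` subject to `q(0) = q⁰`, `q̇(0) = q̇⁰`,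
`q̈ = f(q, q̇) + ρ(q) u`.  `E` and `U` are the model spaces of the configuration space and of
the control fibre, `Q ⊆ E` is the open coordinate domain, and `g = ρ^* g_Q`. -/
structure ControlProblem (E U : Type*) [NormedAddCommGroup E] [NormedSpace ℝ E]
    [NormedAddCommGroup U] [NormedSpace ℝ U] where
  Q : Set E
  f : E → E → E
  rho : E → U →L[ℝ] E
  gQ : E → E →L[ℝ] E →L[ℝ] ℝ
  phi : E → E → ℝ
  q0 : E
  v0 : E
  isOpen_Q : IsOpen Q
  q0_mem : q0 ∈ Q
  contDiff_f : ContDiffOn ℝ 1 (fun z : E × E => f z.1 z.2) (Q ×ˢ univ)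
  /-- `∂f/∂q̇` is `C¹`, so that `d/dt ((∂f/∂q̇)ᵀ λ)` exists along curves. -/
  contDiff_fv : ContDiffOn ℝ 1 (fun z : E × E => fderiv ℝ (f z.1) z.2) (Q ×ˢ univ)
  contDiff_rho : ContDiffOn ℝ 1 rho Q
  contDiff_gQ : ContDiffOn ℝ 1 gQ Q
  contDiff_phi : ContDiffOn ℝ 1 (fun z : E × E => phi z.1 z.2) (Q ×ˢ univ)
  rho_injective : ∀ q ∈ Q, Function.Injective (rho q)
  gQ_symm : ∀ q ∈ Q, ∀ v w, gQ q v w = gQ q w v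
  gQ_pos : ∀ q ∈ Q, ∀ v, v ≠ 0 → 0 < gQ q v v

section Problem

variable {E U : Type*} [NormedAddCommGroup E] [NormedSpace ℝ E]
  [NormedAddCommGroup U] [NormedSpace ℝ U]

/-- The control metric `g(q) = ρ(q)ᵀ g_Q(q) ρ(q)` as a map `u ↦ (g(q) u)ᵀ`. -/
def ControlProblem.g (P : ControlProblem E U) (q : E) : U →L[ℝ] Covec U :=
  (P.gQ q).bilinearComp (P.rho q) (P.rho q)

/-- The new control-dependent Lagrangian
`v_λᵀ v + λᵀ (f(q,v) + ρ(q) u) - ½ uᵀ g(q) u`. -/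
def ControlProblem.lagrangian (P : ControlProblem E U) (q : E) (l : Covec E) (v : E)
    (vl : Covec E) (u : U) : ℝ :=
  vl v + l (P.f q v + P.rho q u) - (1 / 2) * P.g q u u

/-- State dynamics `q̈ = f(q, q̇) + ρ(q) u` on the interval `I`, the curve staying in `Q`. -/
def ControlProblem.StateDynamics (P : ControlProblem E U) (I : Set ℝ) (q : ℝ → E) (u : ℝ → U) :
    Prop :=
  ContDiffOn ℝ 3 q I ∧ ∀ t ∈ I, q t ∈ P.Q ∧
    derivWithin (derivWithin q I) I t = P.f (q t) (derivWithin q I t) + P.rho (q t) (u t)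

/-- Adjoint dynamics
`λ̈ = (∂_q f + ∂_q ρ u)ᵀ λ - d/dt ((∂_q̇ f)ᵀ λ) - ½ (∂_q g (u,u))ᵀ` on the interval `I`. -/
def ControlProblem.AdjointDynamics (P : ControlProblem E U) (I : Set ℝ) (q : ℝ → E)
    (l : ℝ → Covec E) (u : ℝ → U) : Prop :=
  ContDiffOn ℝ 2 l I ∧ ∀ t ∈ I,
    derivWithin (derivWithin l I) I t =
      (l t).comp (fderiv ℝ (fun x => P.f x (derivWithin q I t)) (q t)
        + fderiv ℝ (fun x => P.rho x (u t)) (q t))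
      - derivWithin (fun s => (l s).comp (fderiv ℝ (P.f (q s)) (derivWithin q I s))) I t
      - (1 / 2 : ℝ) • fderiv ℝ (fun x => P.g x (u t) (u t)) (q t)

/-- The continuous control-dependent optimality conditions on `[0,T]`. -/
structure ControlProblem.ContinuousConditions (P : ControlProblem E U) (T : ℝ) (q : ℝ → E)
    (l : ℝ → Covec E) (u : ℝ → U) (mu nu : Covec E) : Prop where
  control_contDiff : ContDiffOn ℝ 1 u (Icc 0 T)
  adjoint : P.AdjointDynamics (Icc 0 T) q l u
  state : P.StateDynamics (Icc 0 T) q u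
  minimisation : ∀ t ∈ Icc 0 T, P.g (q t) (u t) = (l t).comp (P.rho (q t))
  transversality_mu : mu = - derivWithin l (Icc 0 T) 0
    - (l 0).comp (fderiv ℝ (P.f (q 0)) (derivWithin q (Icc 0 T) 0))
  transversality_nu : nu = l 0
  transversality_dl : derivWithin l (Icc 0 T) T =
    fderiv ℝ (fun x => P.phi x (derivWithin q (Icc 0 T) T)) (q T)
    + (fderiv ℝ (P.phi (q T)) (derivWithin q (Icc 0 T) T)).comp
        (fderiv ℝ (P.f (q T)) (derivWithin q (Icc 0 T) T))
  transversality_l : l T = - fderiv ℝ (P.phi (q T)) (derivWithin q (Icc 0 T) T)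
  initial_q : q 0 = P.q0
  initial_v : derivWithin q (Icc 0 T) 0 = P.v0

/-! ### The exact semi-discrete Lagrangian -/

variable {h : ℝ}

/-- `c = q_{k,k+1}` solves the state dynamics under the control `u` on `[0,h]` with
`c(0) = a`, `c(h) = b`. -/
def ControlProblem.StateBVP (P : ControlProblem E U) (a b : E) (u : C1Curve h U)
    (c : C1Curve h E) : Prop :=
  P.StateDynamics (Icc 0 h) (posAt c) (posAt u) ∧ posAt c 0 = a ∧ posAt c h = b

/-- `l = λ_{k,k+1}` solves the adjoint dynamics along the state curve `c` and the control `u` on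
`[0,h]` with `l(0) = la`, `l(h) = lb`. -/
def ControlProblem.AdjointBVP (P : ControlProblem E U) (c : C1Curve h E) (u : C1Curve h U)
    (la lb : Covec E) (l : C1Curve h (Covec E)) : Prop :=
  P.AdjointDynamics (Icc 0 h) (posAt c) (posAt l) (posAt u) ∧ posAt l 0 = la ∧ posAt l h = lb

/-- The state curve `q_{k,k+1}(q_k, q_{k+1}, u_{k,k+1}, h; ·)`: the solution of the state boundary
value problem among the curves in `V`. -/
def ControlProblem.stateSol (P : ControlProblem E U) (V : Set (C1Curve h E))
    (d : E × E × C1Curve h U) : C1Curve h E :=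
  open Classical in
  if hex : ∃ c, c ∈ V ∧ P.StateBVP d.1 d.2.1 d.2.2 c then hex.choose else 0

/-- The adjoint curve `λ_{k,k+1}(q_k, λ_k, q_{k+1}, λ_{k+1}, u_{k,k+1}, h; ·)`. -/
def ControlProblem.adjointSol (P : ControlProblem E U) (V : Set (C1Curve h E))
    (d : E × E × C1Curve h U) (la lb : Covec E) : C1Curve h (Covec E) :=
  open Classical in
  if hex : ∃ l, P.AdjointBVP (P.stateSol V d) d.2.2 la lb l then hex.choose else 0

/-- The standing assumption that the exact semi-discrete Lagrangian is well defined: for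
`(q_k, q_{k+1}, u_{k,k+1})` in the open set `D` the boundary value problem for the state and
adjoint dynamics under the control `u_{k,k+1}` has one and only one solution (with the state curve
in the open set `V`), and its state curve depends differentiably on the data. -/
structure ControlProblem.WellPosed (P : ControlProblem E U) (h : ℝ)
    (D : Set (E × E × C1Curve h U)) (V : Set (C1Curve h E)) : Prop where
  isOpen_D : IsOpen D
  isOpen_V : IsOpen V
  state_unique : ∀ d ∈ D, ∃! c, c ∈ V ∧ P.StateBVP d.1 d.2.1 d.2.2 c
  adjoint_unique : ∀ d ∈ D, ∀ la lb, ∃! l, P.AdjointBVP (P.stateSol V d) d.2.2 la lb l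
  differentiable : DifferentiableOn ℝ (P.stateSol V) D

/-- The exact discrete new control-dependent Lagrangian
`∫₀ʰ L(y_{k,k+1}, ẏ_{k,k+1}, u_{k,k+1}) dt`. -/
def ControlProblem.exactLagrangian (P : ControlProblem E U) (V : Set (C1Curve h E))
    (y y' : E × Covec E) (u : C1Curve h U) : ℝ :=
  ∫ t in (0 : ℝ)..h, P.lagrangian
    (posAt (P.stateSol V (y.1, y'.1, u)) t)
    (posAt (P.adjointSol V (y.1, y'.1, u) y.2 y'.2) t)
    (velAt (P.stateSol V (y.1, y'.1, u)) t)
    (velAt (P.adjointSol V (y.1, y'.1, u) y.2 y'.2) t)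
    (posAt u t)

/-- `v_k^{e,-}(q_k, q_{k+1}, u_{k,k+1}, h)`. -/
def ControlProblem.velMinus (P : ControlProblem E U) (V : Set (C1Curve h E))
    (a b : E) (u : C1Curve h U) : E := velAt (P.stateSol V (a, b, u)) 0

/-- `v_{k+1}^{e,+}(q_k, q_{k+1}, u_{k,k+1}, h)`. -/
def ControlProblem.velPlus (P : ControlProblem E U) (V : Set (C1Curve h E))
    (a b : E) (u : C1Curve h U) : E := velAt (P.stateSol V (a, b, u)) h

/-! ### The discrete objective and the discrete optimality conditions -/

/-- The discrete variables `(y_d, u_d, μ, ν)`. -/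
abbrev DiscreteVars (E U : Type*) [NormedAddCommGroup E] [NormedSpace ℝ E]
    [NormedAddCommGroup U] [NormedSpace ℝ U] (h : ℝ) (N : ℕ) : Type _ :=
  (Fin (N + 1) → E × Covec E) × (Fin N → C1Curve h U) × Covec E × Covec E

section Discrete

variable {N : ℕ}

/-- `y_k` for `0 ≤ k ≤ N`. -/
def node (z : DiscreteVars E U h N) (k : ℕ) : E × Covec E :=
  if hk : k < N + 1 then z.1 ⟨k, hk⟩ else 0

/-- `u_{k,k+1}` for `0 ≤ k ≤ N - 1`. -/
def ctrl (z : DiscreteVars E U h N) (k : ℕ) : C1Curve h U :=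
  if hk : k < N then z.2.1 ⟨k, hk⟩ else 0

/-- The multiplier `μ`. -/
def multMu (z : DiscreteVars E U h N) : Covec E := z.2.2.1

/-- The multiplier `ν`. -/
def multNu (z : DiscreteVars E U h N) : Covec E := z.2.2.2

/-- The data `(q_k, q_{k+1}, u_{k,k+1})` of the `k`-th interval. -/
def segData (z : DiscreteVars E U h N) (k : ℕ) : E × E × C1Curve h U :=
  ((node z k).1, (node z (k + 1)).1, ctrl z k)

/-- All the interval data lie in the domain `D` of the exact discrete Lagrangian. -/
def Admissible (D : Set (E × E × C1Curve h U)) (z : DiscreteVars E U h N) : Prop :=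
  ∀ k < N, segData z k ∈ D

/-- `v_0^{e,-}` at the discrete variables `z`. -/
def ControlProblem.initVel (P : ControlProblem E U) (V : Set (C1Curve h E))
    (z : DiscreteVars E U h N) : E :=
  P.velMinus V (node z 0).1 (node z 1).1 (ctrl z 0)

/-- `v_N^{e,+}` at the discrete variables `z`. -/
def ControlProblem.finalVel (P : ControlProblem E U) (V : Set (C1Curve h E))
    (z : DiscreteVars E U h N) : E :=
  P.velPlus V (node z (N - 1)).1 (node z N).1 (ctrl z (N - 1))

/-- The exact discrete new control-dependent augmented objective. -/
def ControlProblem.discreteObjective (P : ControlProblem E U) (V : Set (C1Curve h E))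
    (z : DiscreteVars E U h N) : ℝ :=
  P.phi (node z N).1 (P.finalVel V z)
    + (node z N).2 (P.finalVel V z) - (node z 0).2 (P.initVel V z)
    + multMu z ((node z 0).1 - P.q0) + multNu z (P.initVel V z - P.v0)
    - ∑ k ∈ Finset.range N, P.exactLagrangian V (node z k) (node z (k + 1)) (ctrl z k)

/-- Stationarity of the objective with respect to all variables `(y_d, u_d, μ, ν)`: its Fréchet
derivative exists and is zero. -/
def ControlProblem.Stationary (P : ControlProblem E U) (V : Set (C1Curve h E))
    (z : DiscreteVars E U h N) : Prop :=
  HasFDerivAt (P.discreteObjective V)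
    (0 : DiscreteVars E U h N →L[ℝ] ℝ) z

/-- `D₁` of the exact discrete Lagrangian. -/
def ControlProblem.D1L (P : ControlProblem E U) (V : Set (C1Curve h E))
    (y y' : E × Covec E) (u : C1Curve h U) : E × Covec E →L[ℝ] ℝ :=
  fderiv ℝ (fun w => P.exactLagrangian V w y' u) y

/-- `D₂` of the exact discrete Lagrangian. -/
def ControlProblem.D2L (P : ControlProblem E U) (V : Set (C1Curve h E))
    (y y' : E × Covec E) (u : C1Curve h U) : E × Covec E →L[ℝ] ℝ :=
  fderiv ℝ (fun w => P.exactLagrangian V y w u) y'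

/-- `D₃` of the exact discrete Lagrangian. -/
def ControlProblem.D3L (P : ControlProblem E U) (V : Set (C1Curve h E))
    (y y' : E × Covec E) (u : C1Curve h U) : C1Curve h U →L[ℝ] ℝ :=
  fderiv ℝ (fun w => P.exactLagrangian V y y' w) u

/-- `D₂ φ(q_N, v_N^{e,+}) + λ_Nᵀ`. -/
def ControlProblem.endDefect (P : ControlProblem E U) (V : Set (C1Curve h E))
    (z : DiscreteVars E U h N) : Covec E :=
  fderiv ℝ (P.phi (node z N).1) (P.finalVel V z) + (node z N).2

/-- `νᵀ - λ_0ᵀ`. -/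
def startDefect (z : DiscreteVars E U h N) : Covec E := multNu z - (node z 0).2

/-- The list of discrete optimality conditions, for `N ≥ 3` (so that `y_1 ≠ y_{N-1}` as
variables). -/
structure ControlProblem.DiscreteConditions (P : ControlProblem E U) (V : Set (C1Curve h E))
    (z : DiscreteVars E U h N) : Prop where
  var_y : ∀ k, 2 ≤ k → k + 2 ≤ N →
    P.D1L V (node z k) (node z (k + 1)) (ctrl z k)
      + P.D2L V (node z (k - 1)) (node z k) (ctrl z (k - 1)) = 0
  var_u : ∀ k, 1 ≤ k → k + 2 ≤ N →
    P.D3L V (node z k) (node z (k + 1)) (ctrl z k) = 0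
  var_q0 :
    (startDefect z).comp
        (fderiv ℝ (fun a => P.velMinus V a (node z 1).1 (ctrl z 0)) (node z 0).1)
      + multMu z
      - fderiv ℝ (fun a => P.exactLagrangian V (a, (node z 0).2) (node z 1) (ctrl z 0))
          (node z 0).1 = 0
  var_y1 :
    (startDefect z).comp
        (fderiv ℝ (fun w : E × Covec E => P.velMinus V (node z 0).1 w.1 (ctrl z 0)) (node z 1))
      - (P.D1L V (node z 1) (node z 2) (ctrl z 1)
          + P.D2L V (node z 0) (node z 1) (ctrl z 0)) = 0
  var_yN1 :
    (P.endDefect V z).comp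
        (fderiv ℝ (fun w : E × Covec E => P.velPlus V w.1 (node z N).1 (ctrl z (N - 1)))
          (node z (N - 1)))
      - (P.D2L V (node z (N - 2)) (node z (N - 1)) (ctrl z (N - 2))
          + P.D1L V (node z (N - 1)) (node z N) (ctrl z (N - 1))) = 0
  var_qN :
    (P.endDefect V z).comp
        (fderiv ℝ (fun b => P.velPlus V (node z (N - 1)).1 b (ctrl z (N - 1))) (node z N).1)
      + fderiv ℝ (fun x => P.phi x (P.finalVel V z)) (node z N).1
      - fderiv ℝ (fun b => P.exactLagrangian V (node z (N - 1)) (b, (node z N).2)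
          (ctrl z (N - 1))) (node z N).1 = 0
  var_u0 :
    (startDefect z).comp
        (fderiv ℝ (fun w => P.velMinus V (node z 0).1 (node z 1).1 w) (ctrl z 0))
      - P.D3L V (node z 0) (node z 1) (ctrl z 0) = 0
  var_uN1 :
    (P.endDefect V z).comp
        (fderiv ℝ (fun w => P.velPlus V (node z (N - 1)).1 (node z N).1 w) (ctrl z (N - 1)))
      - P.D3L V (node z (N - 1)) (node z N) (ctrl z (N - 1)) = 0
  var_mu : (node z 0).1 = P.q0
  var_nu : P.initVel V z = P.v0

/-- The appended equations `λ_0 = ν` and `λ_N = - ∂φ/∂q̇ (q_N, v_N^{e,+})`. -/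
def ControlProblem.Appended (P : ControlProblem E U) (V : Set (C1Curve h E))
    (z : DiscreteVars E U h N) : Prop :=
  (node z 0).2 = multNu z ∧ (node z N).2 = - fderiv ℝ (P.phi (node z N).1) (P.finalVel V z)

/-- `z` consists of the samples `y(kh)` and of the restrictions of `u` to `[kh, (k+1)h]`, and on
each of these intervals the state curve lies in `V`. -/
structure IsSampling (V : Set (C1Curve h E)) (q : ℝ → E) (l : ℝ → Covec E) (u : ℝ → U)
    (z : DiscreteVars E U h N) : Prop where
  nodes : ∀ k ≤ N, node z k = (q (k * h), l (k * h))
  controls : ∀ k < N, ∀ s ∈ Icc 0 h, posAt (ctrl z k) s = u (k * h + s)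
  state_mem : ∀ k < N, ∃ c ∈ V, ∀ s ∈ Icc 0 h, posAt c s = q (k * h + s)

/-- `(q, λ, u)` is, on `[0, Nh]`, the concatenation of the curves `q_{k,k+1}`, `λ_{k,k+1}`,
`u_{k,k+1}`. -/
def ControlProblem.IsConcatenation (P : ControlProblem E U) (V : Set (C1Curve h E))
    (z : DiscreteVars E U h N) (q : ℝ → E) (l : ℝ → Covec E) (u : ℝ → U) : Prop :=
  ∀ k < N, ∀ s ∈ Icc 0 h,
    q (k * h + s) = posAt (P.stateSol V (segData z k)) s ∧
    l (k * h + s) = posAt (P.adjointSol V (segData z k) (node z k).2 (node z (k + 1)).2) s ∧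
    u (k * h + s) = posAt (ctrl z k) s

end Discrete

end Problem

end

noncomputable section

open Filter Topology MeasureTheory

/-! ### Evaluation of `C¹` curves -/

section Curves

variable {F : Type*} [NormedAddCommGroup F] {h : ℝ}

/-! Along a state curve `f + ρ u = q̈`, so the integrand of the exact discrete Lagrangian is `d/dt
(λᵀ q̇) - ½ g(u,u)`. The action therefore sees the adjoint curve only through its end values
(`action_sub_action`): it is affine in `λ_k`, `λ_{k+1}`, with slopes `-q̇(0)` and `q̇(h)`. Near a
given point the adjoint curve may be frozen at the price of two explicit boundary terms, and only
the state curve has to depend differentiably on the data.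

With the adjoint curve frozen, the action is differentiated under the integral sign
(`exists_hasFDerivAt_action`). The adjoint equation is the Euler-Lagrange equation of `q`, with
momentum `p = λ̇ + (∂f/∂q̇)ᵀ λ`, so integration by parts leaves `δλ_{k+1} q̇(h) - δλ_k q̇(0) + p(h)
δq_{k+1} - p(0) δq_k + ∫ (ρᵀ λ - g u) δu dt` as the first variation
(`WellPosed.exists_hasFDerivAt_exactLagrangian`). Its `δλ` terms are assertion 1. Assertion 2 is the
chain rule together with the independence of the variations; the contributions of `δλ_0` and `δλ_N`
cancel identically, so stationarity yields no equation for them and the appended equations are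
genuinely additional.

The appended equations annihilate the coefficients `ν - λ_0` and `D₂φ + λ_N` of the varied end
velocities. The sum then telescopes, and stationarity means (`WellPosed.stationary_iff_matching`):
`q̇` and `p` match at the inner nodes, the boundary conditions hold, and `g u = ρᵀ λ` holds
pointwise by the fundamental lemma of the calculus of variations.

From continuous to discrete, uniqueness identifies the segment curves with restrictions of the given
solution, for which the matching is automatic. Conversely, matching `q`, `q̇`, `λ`, `p` forces `λ̇`
to match, and `u` matches because `g` is injective. The pieces glue to a solution of the first order
system for `(q, q̇, λ, p)` (`FirstOrderDynamics`); `u = g⁻¹ ρᵀ λ` is `C¹`, and the remaining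
regularity follows by bootstrapping. -/

theorem norm_extendZero_le (x : C(Icc (0 : ℝ) h, F)) (s : ℝ) : ‖extendZero x s‖ ≤ ‖x‖ := by
  by_cases hs : s ∈ Icc (0 : ℝ) h
  · simpa [extendZero, hs] using x.norm_coe_le_norm ⟨s, hs⟩
  · simp [extendZero, hs]

theorem continuousOn_extendZero (x : C(Icc (0 : ℝ) h, F)) :
    ContinuousOn (extendZero x) (Icc (0 : ℝ) h) := by
  rw [continuousOn_iff_continuous_domRestrict]
  convert x.continuous using 1
  funext s
  simp [extendZero]

variable [NormedSpace ℝ F]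

/-- Evaluation of a continuous function at `s`, extended by zero. -/
def extendZeroCLM (s : ℝ) : C(Icc (0 : ℝ) h, F) →L[ℝ] F :=
  LinearMap.mkContinuous
    { toFun := fun x => extendZero x s
      map_add' := fun x y => by rw [extendZero_add]; rfl
      map_smul' := fun c x => by rw [extendZero_smul]; rfl } 1
    (fun x => by simpa using norm_extendZero_le x s)

/-- The value at `s` as a continuous linear map on `C¹` curves. -/
def posCLM (s : ℝ) : C1Curve h F →L[ℝ] F :=
  (extendZeroCLM s).comp ((ContinuousLinearMap.fst ℝ _ _).comp (c1Curves h F).subtypeL)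

/-- The derivative at `s` as a continuous linear map on `C¹` curves. -/
def velCLM (s : ℝ) : C1Curve h F →L[ℝ] F :=
  (extendZeroCLM s).comp ((ContinuousLinearMap.snd ℝ _ _).comp (c1Curves h F).subtypeL)

@[simp] theorem posCLM_apply (s : ℝ) (c : C1Curve h F) : posCLM s c = posAt c s := rfl

@[simp] theorem velCLM_apply (s : ℝ) (c : C1Curve h F) : velCLM s c = velAt c s := rfl

theorem norm_posAt_le (c : C1Curve h F) (s : ℝ) : ‖posAt c s‖ ≤ ‖c‖ :=
  (norm_extendZero_le _ _).trans (norm_fst_le c.1)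

theorem norm_velAt_le (c : C1Curve h F) (s : ℝ) : ‖velAt c s‖ ≤ ‖c‖ :=
  (norm_extendZero_le _ _).trans (norm_snd_le c.1)

theorem continuousOn_posAt (c : C1Curve h F) : ContinuousOn (posAt c) (Icc 0 h) :=
  continuousOn_extendZero _

theorem continuousOn_velAt (c : C1Curve h F) : ContinuousOn (velAt c) (Icc 0 h) :=
  continuousOn_extendZero _

/-- Only values on `[0,h]` matter, so this is how restrictions of curves defined on all of `ℝ` enter
the Banach space. -/
theorem exists_posAt_velAt_eq {x x' : ℝ → F} (hx' : ContinuousOn x' (Icc 0 h))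
    (hx : ∀ s ∈ Icc 0 h, HasDerivWithinAt x (x' s) (Icc 0 h) s) :
    ∃ c : C1Curve h F, ∀ s ∈ Icc 0 h, posAt c s = x s ∧ velAt c s = x' s := by
  have hxc : ContinuousOn x (Icc 0 h) := fun s hs => (hx s hs).continuousWithinAt
  let a : C(Icc (0 : ℝ) h, F) := ⟨_, continuousOn_iff_continuous_domRestrict.1 hxc⟩
  let b : C(Icc (0 : ℝ) h, F) := ⟨_, continuousOn_iff_continuous_domRestrict.1 hx'⟩
  have ha : EqOn (extendZero a) x (Icc 0 h) := fun s hs => by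
    simp only [extendZero, hs, dite_true]; rfl
  have hb : EqOn (extendZero b) x' (Icc 0 h) := fun s hs => by
    simp only [extendZero, hs, dite_true]; rfl
  refine ⟨⟨(a, b), fun s hs => ?_⟩, fun s hs => ⟨ha hs, hb hs⟩⟩
  rw [hb hs]
  exact (hx s hs).congr ha (ha hs)

theorem exists_posAt_eq_of_contDiffOn (hh : 0 < h) {x : ℝ → F}
    (hx : ContDiffOn ℝ 1 x (Icc 0 h)) : ∃ c : C1Curve h F, EqOn (posAt c) x (Icc 0 h) := by
  obtain ⟨c, hc⟩ := exists_posAt_velAt_eq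
    (hx.continuousOn_derivWithin (uniqueDiffOn_Icc hh) le_rfl)
    (fun s hs => ((hx.differentiableOn one_ne_zero) s hs).hasDerivWithinAt)
  exact ⟨c, fun s hs => (hc s hs).1⟩

theorem contDiffOn_posAt (hh : 0 < h) (c : C1Curve h F) : ContDiffOn ℝ 1 (posAt c) (Icc 0 h) := by
  rw [contDiffOn_one_iff_derivWithin (uniqueDiffOn_Icc hh)]
  refine ⟨fun s hs => (hasDerivWithinAt_posAt c hs).differentiableWithinAt, ?_⟩
  exact (continuousOn_velAt c).congr fun s hs =>
    (hasDerivWithinAt_posAt c hs).derivWithin (uniqueDiffOn_Icc hh s hs)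

end Curves

/-! ### Differentiation of integral functionals -/

section Integral

variable {G W X : Type*} [NormedAddCommGroup G] [NormedSpace ℝ G] [NormedAddCommGroup W]
  [NormedSpace ℝ W] [NormedAddCommGroup X] [NormedSpace ℝ X]

/-- Strict differentiability gives a first order estimate uniform near each point, continuity of the
derivative allows its base point to move, and compactness makes one `δ` serve all of `K`. -/
theorem IsCompact.exists_norm_sub_sub_fderiv_le {ψ : G → W} {O K : Set G} (hO : IsOpen O)
    (hψ : ContDiffOn ℝ 1 ψ O) (hK : IsCompact K) (hKO : K ⊆ O) {ε : ℝ} (hε : 0 < ε) :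
    ∃ δ > 0, ∀ z ∈ K, ∀ y, ‖y - z‖ < δ →
      ‖ψ y - ψ z - fderiv ℝ ψ z (y - z)‖ ≤ ε * ‖y - z‖ := by
  refine IsCompact.induction_on hK (p := fun s => ∃ δ > 0, ∀ z ∈ s, ∀ y, ‖y - z‖ < δ →
    ‖ψ y - ψ z - fderiv ℝ ψ z (y - z)‖ ≤ ε * ‖y - z‖) ?_ ?_ ?_ ?_
  · exact ⟨1, one_pos, by simp⟩
  · intro s t hst ht
    obtain ⟨δ, hδ, H⟩ := ht
    exact ⟨δ, hδ, fun z hz => H z (hst hz)⟩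
  · intro s t hs ht
    obtain ⟨δ, hδ, H⟩ := hs
    obtain ⟨δ', hδ', H'⟩ := ht
    refine ⟨min δ δ', lt_min hδ hδ', fun z hz y hy => ?_⟩
    rcases hz with hz | hz
    · exact H z hz y (hy.trans_le (min_le_left _ _))
    · exact H' z hz y (hy.trans_le (min_le_right _ _))
  · intro z₀ hz₀
    have hstrict : HasStrictFDerivAt ψ (fderiv ℝ ψ z₀) z₀ :=
      (hψ.contDiffAt (hO.mem_nhds (hKO hz₀))).hasStrictFDerivAt one_ne_zero
    have hcont : ContinuousAt (fderiv ℝ ψ) z₀ :=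
      (hψ.continuousOn_fderiv_of_isOpen hO le_rfl).continuousAt (hO.mem_nhds (hKO hz₀))
    have h1 := hstrict.isLittleO.def (half_pos hε)
    rw [nhds_prod_eq, Metric.nhds_basis_ball.prod_self.eventually_iff] at h1
    obtain ⟨r, hr, h1⟩ := h1
    obtain ⟨r', hr', h2⟩ := Metric.continuousAt_iff.1 hcont (ε / 2) (half_pos hε)
    -- Radius `r / 2` for both `z` and `y - z` keeps the pair in the ball of radius `r` where the
    -- strict estimate holds with `ε / 2`; the other `ε / 2` pays for replacing the derivative at
    -- `z₀` by that at `z`.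
    refine ⟨Metric.ball z₀ (min (r / 2) r'),
      mem_nhdsWithin_of_mem_nhds (Metric.ball_mem_nhds _ (lt_min (half_pos hr) hr')), r / 2,
      half_pos hr, fun z hz y hy => ?_⟩
    rw [Metric.mem_ball, lt_min_iff] at hz
    have hy' : dist y z₀ < r := by
      have := dist_triangle y z z₀
      rw [dist_eq_norm y z] at this
      linarith [hz.1]
    have e1 := @h1 (y, z) ⟨hy', by rw [Metric.mem_ball]; linarith [hz.1]⟩
    have e2 : ‖(fderiv ℝ ψ z - fderiv ℝ ψ z₀) (y - z)‖ ≤ ε / 2 * ‖y - z‖ := by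
      refine (ContinuousLinearMap.le_opNorm _ _).trans ?_
      gcongr
      rw [← dist_eq_norm]
      exact (h2 hz.2).le
    calc ‖ψ y - ψ z - fderiv ℝ ψ z (y - z)‖
        = ‖(ψ y - ψ z - fderiv ℝ ψ z₀ (y - z))
            - (fderiv ℝ ψ z - fderiv ℝ ψ z₀) (y - z)‖ := by
          congr 1
          rw [_root_.sub_apply]
          abel
      _ ≤ ε / 2 * ‖y - z‖ + ε / 2 * ‖y - z‖ := (norm_sub_le _ _).trans (add_le_add e1 e2)
      _ = ε * ‖y - z‖ := by ring

/-- The trajectory `t ↦ ev t x₀` has compact image in `O`, so the first order remainder is small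
uniformly in `t` and can be integrated. Continuity in `t` is asked only pointwise in `x`: evaluation
of a derivative is in general not norm continuous in `t`. -/
theorem exists_hasFDerivAt_integral_comp {ψ : G → ℝ} {O : Set G} (hO : IsOpen O)
    (hψ : ContDiffOn ℝ 1 ψ O) {h : ℝ} (hh : 0 ≤ h) (ev : ℝ → X →L[ℝ] G)
    (hev : ∀ t ∈ Icc 0 h, ∀ x, ‖ev t x‖ ≤ ‖x‖)
    (hcont : ∀ x, ContinuousOn (fun t => ev t x) (Icc 0 h)) {x₀ : X}
    (hx₀ : ∀ t ∈ Icc 0 h, ev t x₀ ∈ O) :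
    ∃ A : X →L[ℝ] ℝ, HasFDerivAt (fun x => ∫ t in (0 : ℝ)..h, ψ (ev t x)) A x₀ ∧
      ∀ d, A d = ∫ t in (0 : ℝ)..h, fderiv ℝ ψ (ev t x₀) (ev t d) := by
  have hK : IsCompact ((fun t => ev t x₀) '' Icc 0 h) := isCompact_Icc.image_of_continuousOn (hcont x₀)
  have hKO : (fun t => ev t x₀) '' Icc 0 h ⊆ O := by
    rintro _ ⟨t, ht, rfl⟩
    exact hx₀ t ht
  have hψ' : ContinuousOn (fun t => fderiv ℝ ψ (ev t x₀)) (Icc 0 h) :=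
    (hψ.continuousOn_fderiv_of_isOpen hO le_rfl).comp (hcont x₀) hx₀
  obtain ⟨C, hC⟩ := isCompact_Icc.exists_bound_of_continuousOn hψ'
  have hint : ∀ d, IntervalIntegrable (fun t => fderiv ℝ ψ (ev t x₀) (ev t d)) volume 0 h :=
    fun d => ContinuousOn.intervalIntegrable_of_Icc hh (hψ'.clm_apply (hcont d))
  let A : X →L[ℝ] ℝ := LinearMap.mkContinuous
    { toFun := fun d => ∫ t in (0 : ℝ)..h, fderiv ℝ ψ (ev t x₀) (ev t d)
      map_add' := fun d d' => by
        simp only [map_add]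
        exact intervalIntegral.integral_add (hint d) (hint d')
      map_smul' := fun c d => by
        simp only [map_smul, smul_eq_mul, RingHom.id_apply]
        exact intervalIntegral.integral_const_mul _ _ } (C * |h - 0|)
    (fun d => by
      have := intervalIntegral.norm_integral_le_of_norm_le_const (a := 0) (b := h)
        (C := C * ‖d‖) (f := fun t => fderiv ℝ ψ (ev t x₀) (ev t d)) (fun t ht => by
          rw [uIoc_of_le hh] at ht
          have ht' := Ioc_subset_Icc_self ht
          refine (ContinuousLinearMap.le_opNorm _ _).trans ?_
          exact mul_le_mul (hC t ht') (hev t ht' d) (norm_nonneg _)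
            ((norm_nonneg _).trans (hC t ht')))
      calc _ ≤ C * ‖d‖ * |h - 0| := this
        _ = _ := by ring)
  have hA : ∀ d, A d = ∫ t in (0 : ℝ)..h, fderiv ℝ ψ (ev t x₀) (ev t d) := fun d => rfl
  refine ⟨A, ?_, hA⟩
  rw [hasFDerivAt_iff_isLittleO, Asymptotics.isLittleO_iff]
  intro ε hε
  -- Integration over an interval of length `h` multiplies the bound by `h`, and `h / (h + 1) ≤ 1`
  -- also when `h = 0`.
  have hε' : 0 < ε / (h + 1) := by positivity
  obtain ⟨δ, hδ, H⟩ := IsCompact.exists_norm_sub_sub_fderiv_le hO hψ hK hKO hε'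
  -- A uniform tube around the compact trajectory keeps all nearby trajectories inside `O`.
  obtain ⟨δ', hδ', H'⟩ := hK.exists_thickening_subset_open hO hKO
  filter_upwards [Metric.ball_mem_nhds x₀ (lt_min hδ hδ')] with x hx
  rw [Metric.mem_ball, dist_eq_norm, lt_min_iff] at hx
  have hsub : ∀ t ∈ Icc 0 h, ‖ev t x - ev t x₀‖ ≤ ‖x - x₀‖ := fun t ht => by
    rw [← map_sub]
    exact hev t ht _
  have hxO : ∀ t ∈ Icc 0 h, ev t x ∈ O := fun t ht =>
    H' (Metric.mem_thickening_iff.2 ⟨_, ⟨t, ht, rfl⟩, by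
      rw [dist_eq_norm]; exact (hsub t ht).trans_lt hx.2⟩)
  have hint1 : ∀ y, (∀ t ∈ Icc 0 h, ev t y ∈ O) →
      IntervalIntegrable (fun t => ψ (ev t y)) volume 0 h := fun y hy =>
    ContinuousOn.intervalIntegrable_of_Icc hh (hψ.continuousOn.comp (hcont y) hy)
  rw [hA, ← intervalIntegral.integral_sub (hint1 x hxO) (hint1 x₀ hx₀),
    ← intervalIntegral.integral_sub ((hint1 x hxO).sub (hint1 x₀ hx₀)) (hint _)]
  calc _ ≤ ε / (h + 1) * ‖x - x₀‖ * |h - 0| := by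
        refine intervalIntegral.norm_integral_le_of_norm_le_const fun t ht => ?_
        rw [uIoc_of_le hh] at ht
        have ht' := Ioc_subset_Icc_self ht
        rw [map_sub]
        refine (H _ ⟨t, ht', rfl⟩ _ ((hsub t ht').trans_lt hx.1)).trans ?_
        gcongr
        exact hsub t ht'
    _ = ε * ‖x - x₀‖ * (h / (h + 1)) := by
        rw [sub_zero, abs_of_nonneg hh]
        ring
    _ ≤ ε * ‖x - x₀‖ * 1 := by
        gcongr
        rw [div_le_one (by positivity)]
        linarith
    _ = ε * ‖x - x₀‖ := mul_one _

/-- A curve `w` all of whose moments `∫ w(δ)` against `C¹` curves `δ` vanish is zero. -/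
theorem eqOn_zero_of_integral_apply_eq_zero {U : Type*} [NormedAddCommGroup U] [NormedSpace ℝ U]
    {h : ℝ} (hh : 0 < h) {w : ℝ → U →L[ℝ] ℝ} (hw : ContDiffOn ℝ 1 w (Icc 0 h))
    (H : ∀ c : C1Curve h U, ∫ t in (0 : ℝ)..h, w t (posAt c t) = 0) :
    ∀ t ∈ Icc 0 h, w t = 0 := by
  intro t ht
  ext e
  have hwe : ContDiffOn ℝ 1 (fun s => w s e) (Icc 0 h) := hw.clm_apply contDiffOn_const
  -- The test curve `s ↦ w(s)(e) e` turns the moment into `∫ w(s)(e)²`; it is admissible because `w`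
  -- is `C¹`.
  obtain ⟨c, hc⟩ := exists_posAt_eq_of_contDiffOn hh (hwe.smul contDiffOn_const : ContDiffOn ℝ 1
    (fun s => w s e • e) (Icc 0 h))
  have h0 : ∫ s in (0 : ℝ)..h, (w s e) ^ 2 = 0 := by
    refine (intervalIntegral.integral_congr fun s hs => ?_).trans (H c)
    rw [uIcc_of_le hh.le] at hs
    simp only [hc hs, Pi.smul_apply', map_smul, smul_eq_mul, sq]
  by_contra hne
  refine absurd h0 (intervalIntegral.integral_pos hh (hwe.continuousOn.pow 2)
    (fun s _ => sq_nonneg _) ⟨t, ht, ?_⟩).ne'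
  exact sq_pos_iff.2 hne

end Integral

/-! ### Restriction and gluing of curves -/

section Glue

variable {F : Type*} [NormedAddCommGroup F] [NormedSpace ℝ F] {h : ℝ} {N : ℕ}

theorem natCast_mul_add_mem_Icc {k : ℕ} (hk : k < N) {s : ℝ} (hs : s ∈ Icc 0 h) :
    k * h + s ∈ Icc 0 (N * h) := by
  have hh : 0 ≤ h := hs.1.trans hs.2
  have h1 : ((k : ℝ) + 1) * h ≤ N * h := by
    gcongr
    exact_mod_cast hk
  have h2 : 0 ≤ (k : ℝ) * h := by positivity
  exact ⟨add_nonneg h2 hs.1, by linarith [hs.2]⟩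

theorem HasDerivWithinAt.comp_natCast_mul_add {x : ℝ → F} {x' : F} {k : ℕ} (hk : k < N) {s : ℝ}
    (hx : HasDerivWithinAt x x' (Icc 0 (N * h)) (k * h + s)) :
    HasDerivWithinAt (fun r => x (k * h + r)) x' (Icc 0 h) s := by
  simpa [Function.comp_def] using hx.scomp s ((hasDerivWithinAt_id s (Icc 0 h)).const_add (k * h))
    (fun r hr => natCast_mul_add_mem_Icc hk hr)

theorem exists_mem_Icc_natCast_mul_add_eq {t : ℝ} (hN : 0 < N)
    (ht : t ∈ Icc 0 (N * h)) : ∃ k < N, ∃ s ∈ Icc 0 h, k * h + s = t := by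
  induction N with
  | zero => omega
  | succ n ih =>
    push_cast at ht
    by_cases hle : t ≤ n * h
    · rcases Nat.eq_zero_or_pos n with rfl | hn
      · refine ⟨0, by omega, t, ⟨ht.1, ?_⟩, by simp⟩
        simpa using ht.2
      · obtain ⟨k, hk, H⟩ := ih hn ⟨ht.1, hle⟩
        exact ⟨k, by omega, H⟩
    · exact ⟨n, by omega, t - n * h, ⟨by linarith, by linarith [ht.2]⟩, by ring⟩

/-- The same `x'` serves on both sides, so the one-sided derivatives agree at `b`. Away from one of
the closed intervals, differentiability within it is vacuous. -/
theorem HasDerivWithinAt.Icc_union_Icc {x : ℝ → F} {x' : ℝ → F} {a b c : ℝ} (hab : a ≤ b)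
    (hbc : b ≤ c) (h₁ : ∀ t ∈ Icc a b, HasDerivWithinAt x (x' t) (Icc a b) t)
    (h₂ : ∀ t ∈ Icc b c, HasDerivWithinAt x (x' t) (Icc b c) t) :
    ∀ t ∈ Icc a c, HasDerivWithinAt x (x' t) (Icc a c) t := by
  have aux : ∀ {u v t : ℝ}, (t ∈ Icc u v → HasDerivWithinAt x (x' t) (Icc u v) t) →
      HasDerivWithinAt x (x' t) (Icc u v) t := fun {u v t} H => by
    by_cases ht : t ∈ Icc u v
    · exact H ht
    · exact HasFDerivWithinAt.of_notMem_closure (by rwa [isClosed_Icc.closure_eq])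
  intro t _
  rw [← Icc_union_Icc_eq_Icc hab hbc]
  exact (aux (h₁ t)).union (aux (h₂ t))

theorem hasDerivWithinAt_of_comp_natCast_mul_add (hh : 0 ≤ h) (hN : 0 < N) {x x' : ℝ → F}
    (H : ∀ k < N, ∀ s ∈ Icc 0 h,
      HasDerivWithinAt (fun r => x (k * h + r)) (x' (k * h + s)) (Icc 0 h) s) :
    ∀ t ∈ Icc 0 (N * h), HasDerivWithinAt x (x' t) (Icc 0 (N * h)) t := by
  have piece : ∀ k < N, ∀ t ∈ Icc (k * h) (k * h + h),
      HasDerivWithinAt x (x' t) (Icc (k * h) (k * h + h)) t := fun k hk t ht => by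
    have hmaps : MapsTo (fun r => r - k * h) (Icc (k * h) (k * h + h)) (Icc 0 h) :=
      fun r hr => ⟨by linarith [hr.1], by linarith [hr.2]⟩
    have := (H k hk (t - k * h) (hmaps ht)).scomp t
      ((hasDerivWithinAt_id t (Icc (k * h) (k * h + h))).sub_const (k * h)) hmaps
    simpa [Function.comp_def] using this
  induction N with
  | zero => omega
  | succ n ih =>
    rcases Nat.eq_zero_or_pos n with rfl | hn
    · simpa using piece 0 (by omega)
    · have e : ((n + 1 : ℕ) : ℝ) * h = n * h + h := by push_cast; ring
      rw [e]
      exact HasDerivWithinAt.Icc_union_Icc (by positivity) (by linarith)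
        (ih hn (fun k hk => H k (by omega)) (fun k hk => piece k (by omega))) (piece n (by omega))

theorem continuousOn_of_comp_natCast_mul_add {F : Type*} [TopologicalSpace F] (hh : 0 ≤ h)
    (hN : 0 < N) {x : ℝ → F}
    (H : ∀ k < N, ContinuousOn (fun r => x (k * h + r)) (Icc 0 h)) :
    ContinuousOn x (Icc 0 (N * h)) := by
  have piece : ∀ k < N, ContinuousOn x (Icc (k * h) (k * h + h)) := fun k hk => by
    have := (H k hk).comp (t := Icc 0 h) (f := fun t => t - k * h) (s := Icc (k * h) (k * h + h))
      (by fun_prop) (fun r hr => ⟨by simpa using hr.1, by simpa [add_comm] using hr.2⟩)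
    simpa [Function.comp_def] using this
  induction N with
  | zero => omega
  | succ n ih =>
    rcases Nat.eq_zero_or_pos n with rfl | hn
    · simpa using piece 0 (by omega)
    · have e : ((n + 1 : ℕ) : ℝ) * h = n * h + h := by push_cast; ring
      rw [e, ← Icc_union_Icc_eq_Icc (b := (n : ℝ) * h) (by positivity) (by linarith)]
      exact (ih hn (fun k hk => H k (by omega)) (fun k hk => piece k (by omega))).union_of_isClosed
        (piece n (by omega)) isClosed_Icc isClosed_Icc

/-- Curves on `[0,h]` with matching end points concatenate. -/
theorem exists_concatenation {F : Type*} (x : ℕ → ℝ → F) (hh : 0 < h) (N : ℕ)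
    (H : ∀ k, k + 1 < N → x k h = x (k + 1) 0) :
    ∃ X : ℝ → F, ∀ k < N, ∀ s ∈ Icc 0 h, X (k * h + s) = x k s := by
  induction N with
  | zero => exact ⟨x 0, by simp⟩
  | succ n ih =>
    obtain ⟨X, hX⟩ := ih fun k hk => H k (by omega)
    rcases Nat.eq_zero_or_pos n with rfl | hn
    · refine ⟨x 0, fun k hk s _ => ?_⟩
      obtain rfl : k = 0 := by omega
      simp
    -- At the joint `t = n h` the old piece is used; the matching hypothesis shows that the new
    -- piece has the same value there.
    refine ⟨fun t => if t ≤ n * h then X t else x n (t - n * h), fun k hk s hs => ?_⟩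
    beta_reduce
    rcases Nat.lt_succ_iff_lt_or_eq.1 hk with hk | rfl
    · rw [if_pos (natCast_mul_add_mem_Icc hk hs).2, hX k hk s hs]
    · rcases hs.1.eq_or_lt with rfl | hs0
      · obtain ⟨m, rfl⟩ : ∃ m, k = m + 1 := ⟨k - 1, by omega⟩
        have := hX m (by omega) h ⟨hh.le, le_rfl⟩
        rw [if_pos (by simp), ← H m (by omega), ← this]
        congr 1
        push_cast
        ring
      · rw [if_neg (by linarith)]
        simp

theorem contDiffOn_of_hasDerivWithinAt {x x' : ℝ → F} {n m : WithTop ℕ∞} {T : ℝ} (hT : 0 < T)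
    (hn : n ≠ ⊤) (hm : n + 1 = m)
    (hx : ∀ t ∈ Icc 0 T, HasDerivWithinAt x (x' t) (Icc 0 T) t)
    (hx' : ContDiffOn ℝ n x' (Icc 0 T)) : ContDiffOn ℝ m x (Icc 0 T) := by
  rw [← hm, contDiffOn_succ_iff_derivWithin (uniqueDiffOn_Icc hT)]
  -- The middle condition concerns only the analytic order `⊤`, which `hn` excludes.
  refine ⟨fun t ht => (hx t ht).differentiableWithinAt, fun h => absurd h hn, ?_⟩
  exact hx'.congr fun t ht => (hx t ht).derivWithin (uniqueDiffOn_Icc hT t ht)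

theorem contDiffOn_one_of_hasDerivWithinAt {x x' : ℝ → F} {T : ℝ} (hT : 0 < T)
    (hx : ∀ t ∈ Icc 0 T, HasDerivWithinAt x (x' t) (Icc 0 T) t)
    (hx' : ContinuousOn x' (Icc 0 T)) : ContDiffOn ℝ 1 x (Icc 0 T) :=
  contDiffOn_of_hasDerivWithinAt hT (by simp) (zero_add 1) hx (contDiffOn_zero.2 hx')

end Glue

/-! ### The state and adjoint dynamics as a first order system -/

section Problem

variable {E U : Type*} [NormedAddCommGroup E] [NormedSpace ℝ E]
  [NormedAddCommGroup U] [NormedSpace ℝ U]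

namespace ControlProblem

/-- `∂f/∂q̇`. -/
def fv (P : ControlProblem E U) (x v : E) : E →L[ℝ] E := fderiv ℝ (P.f x) v

/-- The momentum `(λ̇ + (∂f/∂q̇)ᵀ λ)ᵀ` conjugate to `q`. -/
def momentum (P : ControlProblem E U) (x v : E) (l m : Covec E) : Covec E := m + l.comp (P.fv x v)

/-- The rate `((∂f/∂q + ∂ρ/∂q u)ᵀ λ - ½ (∂g/∂q (u,u))ᵀ)ᵀ` of the momentum. -/
def force (P : ControlProblem E U) (x v : E) (l : Covec E) (w : U) : Covec E :=
  l.comp (fderiv ℝ (fun y => P.f y v) x + fderiv ℝ (fun y => P.rho y w) x)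
    - (1 / 2 : ℝ) • fderiv ℝ (fun y => P.g y w w) x

theorem isOpen_prod_univ (P : ControlProblem E U) : IsOpen (P.Q ×ˢ (univ : Set E)) :=
  P.isOpen_Q.prod isOpen_univ

theorem contDiffOn_g (P : ControlProblem E U) : ContDiffOn ℝ 1 P.g P.Q := by
  have h1 : ContDiffOn ℝ 1 (fun q => (P.gQ q).comp (P.rho q)) P.Q :=
    P.contDiff_gQ.clm_comp P.contDiff_rho
  -- The pullback of the bilinear form is split into `g_Q(q) ∘ ρ(q)` followed by precomposition with
  -- `ρ(q)`, each of which is `C¹` in `q`.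
  have h2 : ContDiffOn ℝ 1 (fun q => (ContinuousLinearMap.compL ℝ U E ℝ).flip (P.rho q)) P.Q :=
    (ContinuousLinearMap.contDiff _).comp_contDiffOn P.contDiff_rho
  refine (h2.clm_comp h1).congr fun q _ => ?_
  ext u w
  rfl

theorem g_symm (P : ControlProblem E U) {q : E} (hq : q ∈ P.Q) (u w : U) :
    P.g q u w = P.g q w u := P.gQ_symm q hq _ _

/-- The pullback of a positive definite form by an injective map is positive definite. -/
theorem g_injective (P : ControlProblem E U) {q : E} (hq : q ∈ P.Q) :
    Function.Injective (P.g q) := by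
  rw [injective_iff_map_eq_zero]
  intro u hu
  by_contra hne
  have h0 : P.gQ q (P.rho q u) (P.rho q u) = 0 := DFunLike.congr_fun hu u
  refine (P.gQ_pos q hq (P.rho q u) fun h => hne ?_).ne' h0
  exact P.rho_injective q hq (h.trans (map_zero _).symm)

/-! ### Regularity of the data along curves. -/

section Continuity

variable (P : ControlProblem E U) {q v : ℝ → E} {l : ℝ → Covec E} {u : ℝ → U}

theorem contDiffOn_f_comp {I : Set ℝ} (hQ : ∀ t ∈ I, q t ∈ P.Q) (hq : ContDiffOn ℝ 1 q I)
    (hv : ContDiffOn ℝ 1 v I) : ContDiffOn ℝ 1 (fun t => P.f (q t) (v t)) I :=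
  P.contDiff_f.comp (hq.prodMk hv) fun t ht => ⟨hQ t ht, mem_univ _⟩

theorem contDiffOn_fv_comp {I : Set ℝ} (hQ : ∀ t ∈ I, q t ∈ P.Q) (hq : ContDiffOn ℝ 1 q I)
    (hv : ContDiffOn ℝ 1 v I) : ContDiffOn ℝ 1 (fun t => P.fv (q t) (v t)) I :=
  P.contDiff_fv.comp (hq.prodMk hv) fun t ht => ⟨hQ t ht, mem_univ _⟩

theorem continuousOn_f_comp {I : Set ℝ} (hQ : ∀ t ∈ I, q t ∈ P.Q) (hq : ContinuousOn q I)
    (hv : ContinuousOn v I) : ContinuousOn (fun t => P.f (q t) (v t)) I :=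
  P.contDiff_f.continuousOn.comp (hq.prodMk hv) fun t ht => ⟨hQ t ht, mem_univ _⟩

/-- The partial derivative `∂f/∂q` in terms of the full derivative. -/
theorem hasFDerivAt_f_fst {x : E} (hx : x ∈ P.Q) (w : E) :
    HasFDerivAt (fun y => P.f y w)
      ((fderiv ℝ (fun z : E × E => P.f z.1 z.2) (x, w)).comp (ContinuousLinearMap.inl ℝ E E)) x := by
  have h1 : HasFDerivAt (fun z : E × E => P.f z.1 z.2) _ (x, w) :=
    ((P.contDiff_f.contDiffAt (P.isOpen_prod_univ.mem_nhds ⟨hx, mem_univ _⟩)).differentiableAt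
      one_ne_zero).hasFDerivAt
  exact h1.comp x (f := fun y => (y, w)) (hasFDerivAt_prodMk_left x w)

theorem hasFDerivAt_rho_apply {x : E} (hx : x ∈ P.Q) (w : U) :
    HasFDerivAt (fun y => P.rho y w) ((ContinuousLinearMap.apply ℝ E w).comp (fderiv ℝ P.rho x)) x := by
  have h1 := ((P.contDiff_rho.contDiffAt (P.isOpen_Q.mem_nhds hx)).differentiableAt
      one_ne_zero).hasFDerivAt
  exact (ContinuousLinearMap.apply ℝ E w).hasFDerivAt.comp x (f := P.rho) h1

theorem hasFDerivAt_g_apply {x : E} (hx : x ∈ P.Q) (w : U) :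
    HasFDerivAt (fun y => P.g y w w)
      (((ContinuousLinearMap.apply ℝ ℝ w).comp (ContinuousLinearMap.apply ℝ (Covec U) w)).comp
        (fderiv ℝ P.g x)) x := by
  have h1 := ((P.contDiffOn_g.contDiffAt (P.isOpen_Q.mem_nhds hx)).differentiableAt
      one_ne_zero).hasFDerivAt
  exact ((ContinuousLinearMap.apply ℝ ℝ w).comp
    (ContinuousLinearMap.apply ℝ (Covec U) w)).hasFDerivAt.comp x (f := P.g) h1

-- The force is built from partial derivatives at moving base points; expressing these by the total
-- derivatives of `f`, `ρ` and `g` makes their joint continuity visible.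
set_option maxSynthPendingDepth 3 in
theorem continuousOn_force {I : Set ℝ} (hQ : ∀ t ∈ I, q t ∈ P.Q) (hq : ContinuousOn q I)
    (hv : ContinuousOn v I) (hl : ContinuousOn l I) (hu : ContinuousOn u I) :
    ContinuousOn (fun t => P.force (q t) (v t) (l t) (u t)) I := by
  have hf : ContinuousOn (fun t => fderiv ℝ (fun z : E × E => P.f z.1 z.2) (q t, v t)) I :=
    (P.contDiff_f.continuousOn_fderiv_of_isOpen P.isOpen_prod_univ le_rfl).comp (hq.prodMk hv)
      fun t ht => ⟨hQ t ht, mem_univ _⟩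
  have hr : ContinuousOn (fun t => fderiv ℝ P.rho (q t)) I :=
    (P.contDiff_rho.continuousOn_fderiv_of_isOpen P.isOpen_Q le_rfl).comp hq hQ
  have hg : ContinuousOn (fun t => fderiv ℝ P.g (q t)) I :=
    (P.contDiffOn_g.continuousOn_fderiv_of_isOpen P.isOpen_Q le_rfl).comp hq hQ
  have hE : ContinuousOn (fun t => ContinuousLinearMap.apply ℝ E (u t)) I :=
    (ContinuousLinearMap.apply ℝ E : U →L[ℝ] _).continuous.comp_continuousOn hu
  have hU : ContinuousOn (fun t => ContinuousLinearMap.apply ℝ (Covec U) (u t)) I :=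
    (ContinuousLinearMap.apply ℝ (Covec U) : U →L[ℝ] _).continuous.comp_continuousOn hu
  have hR : ContinuousOn (fun t => ContinuousLinearMap.apply ℝ ℝ (u t)) I :=
    (ContinuousLinearMap.apply ℝ ℝ : U →L[ℝ] _).continuous.comp_continuousOn hu
  refine ContinuousOn.congr (hl.clm_comp ((hf.clm_comp (continuousOn_const
    (c := ContinuousLinearMap.inl ℝ E E))).add (hE.clm_comp hr)) |>.sub
    (((hR.clm_comp hU).clm_comp hg).const_smul (1 / 2 : ℝ))) fun t ht => ?_
  · rw [force, (P.hasFDerivAt_f_fst (hQ t ht) _).fderiv,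
      (P.hasFDerivAt_rho_apply (hQ t ht) _).fderiv, (P.hasFDerivAt_g_apply (hQ t ht) _).fderiv]
    rfl

end Continuity

/-- The state and adjoint dynamics as a first order system for `(q, v, λ, momentum)`. -/
structure FirstOrderDynamics (P : ControlProblem E U) (I : Set ℝ) (q v : ℝ → E)
    (l m : ℝ → Covec E) (u : ℝ → U) : Prop where
  mem : ∀ t ∈ I, q t ∈ P.Q
  deriv_q : ∀ t ∈ I, HasDerivWithinAt q (v t) I t
  deriv_v : ∀ t ∈ I, HasDerivWithinAt v (P.f (q t) (v t) + P.rho (q t) (u t)) I t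
  deriv_l : ∀ t ∈ I, HasDerivWithinAt l (m t) I t
  deriv_momentum : ∀ t ∈ I, HasDerivWithinAt (fun s => P.momentum (q s) (v s) (l s) (m s))
    (P.force (q t) (v t) (l t) (u t)) I t

variable {P : ControlProblem E U} {T : ℝ} {q v : ℝ → E} {l m : ℝ → Covec E} {u : ℝ → U}

/-- Moving `d/dt ((∂f/∂q̇)ᵀ λ)` to the left turns the adjoint equation into `ṗ = force`. The term is
differentiable since `∂f/∂q̇` is `C¹` and `λ`, `q`, `q̇` are at least `C¹`. -/
theorem FirstOrderDynamics.of_dynamics (hT : 0 < T)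
    (hq : ∀ t ∈ Icc 0 T, HasDerivWithinAt q (v t) (Icc 0 T) t)
    (hl : ∀ t ∈ Icc 0 T, HasDerivWithinAt l (m t) (Icc 0 T) t)
    (hs : P.StateDynamics (Icc 0 T) q u) (ha : P.AdjointDynamics (Icc 0 T) q l u) :
    P.FirstOrderDynamics (Icc 0 T) q v l m u := by
  have hU := uniqueDiffOn_Icc hT
  have eqv : EqOn (derivWithin q (Icc 0 T)) v (Icc 0 T) := fun t ht =>
    (hq t ht).derivWithin (hU t ht)
  have eqm : EqOn (derivWithin l (Icc 0 T)) m (Icc 0 T) := fun t ht =>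
    (hl t ht).derivWithin (hU t ht)
  have hv1 : ContDiffOn ℝ 1 v (Icc 0 T) :=
    ((hs.1.derivWithin hU (m := 1) (by norm_num))).congr fun t ht => (eqv ht).symm
  have hm1 : ContDiffOn ℝ 1 m (Icc 0 T) :=
    ((ha.1.derivWithin hU (m := 1) (by norm_num))).congr fun t ht => (eqm ht).symm
  have hQ : ∀ t ∈ Icc 0 T, q t ∈ P.Q := fun t ht => (hs.2 t ht).1
  have hlf : ContDiffOn ℝ 1 (fun t => (l t).comp (P.fv (q t) (v t))) (Icc 0 T) :=
    (ha.1.of_le (by norm_num)).clm_comp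
      (P.contDiffOn_fv_comp hQ (hs.1.of_le (by norm_num)) hv1)
  refine ⟨hQ, hq, fun t ht => ?_, hl, fun t ht => ?_⟩
  · have h1 := (hv1.differentiableOn one_ne_zero t ht).hasDerivWithinAt
    have h2 := (hs.2 t ht).2
    rw [derivWithin_congr eqv (eqv ht), eqv ht] at h2
    rwa [h2] at h1
  · have h1 := (hm1.differentiableOn one_ne_zero t ht).hasDerivWithinAt
    have h3 := (hlf.differentiableOn one_ne_zero t ht).hasDerivWithinAt
    have h2 := ha.2 t ht
    have e : EqOn (fun s => (l s).comp (fderiv ℝ (P.f (q s)) (derivWithin q (Icc 0 T) s)))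
        (fun t => (l t).comp (P.fv (q t) (v t))) (Icc 0 T) := fun s hs => by
      simp only [eqv hs, fv]
    rw [derivWithin_congr eqm (eqm ht), derivWithin_congr e (e ht), eqv ht] at h2
    refine (h1.add h3).congr_deriv ?_
    rw [h2, force]
    abel

/-- Bootstrapping: `v̇ = f + ρ u` is continuous, so `v` is `C¹`; then `v̇` is `C¹`, so `v` is `C²`
and `q` is `C³`. -/
theorem FirstOrderDynamics.stateDynamics (H : P.FirstOrderDynamics (Icc 0 T) q v l m u)
    (hT : 0 < T) (hu : ContDiffOn ℝ 1 u (Icc 0 T)) : P.StateDynamics (Icc 0 T) q u := by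
  have hU := uniqueDiffOn_Icc hT
  have eqv : EqOn (derivWithin q (Icc 0 T)) v (Icc 0 T) := fun t ht =>
    (H.deriv_q t ht).derivWithin (hU t ht)
  have hqc : ContinuousOn q (Icc 0 T) := fun t ht => (H.deriv_q t ht).continuousWithinAt
  have hvc : ContinuousOn v (Icc 0 T) := fun t ht => (H.deriv_v t ht).continuousWithinAt
  have hq1 : ContDiffOn ℝ 1 q (Icc 0 T) := contDiffOn_one_of_hasDerivWithinAt hT H.deriv_q hvc
  have hv1 : ContDiffOn ℝ 1 v (Icc 0 T) := contDiffOn_one_of_hasDerivWithinAt hT H.deriv_v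
    ((P.continuousOn_f_comp H.mem hqc hvc).add
      ((P.contDiff_rho.continuousOn.comp hqc H.mem).clm_apply hu.continuousOn))
  have hv2 : ContDiffOn ℝ 2 v (Icc 0 T) :=
    contDiffOn_of_hasDerivWithinAt hT (by simp) one_add_one_eq_two H.deriv_v
      ((P.contDiffOn_f_comp H.mem hq1 hv1).add ((P.contDiff_rho.comp hq1 H.mem).clm_apply hu))
  refine ⟨contDiffOn_of_hasDerivWithinAt hT (by simp) (by norm_num) H.deriv_q hv2,
    fun t ht => ⟨H.mem t ht, ?_⟩⟩
  · rw [derivWithin_congr eqv (eqv ht), eqv ht, (H.deriv_v t ht).derivWithin (hU t ht)]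

/-- The momentum is `C¹` because its derivative, the force, is continuous. Subtracting the `C¹`
curve `(∂f/∂q̇)ᵀ λ` shows that `λ̇` is `C¹` and recovers the second order equation. -/
theorem FirstOrderDynamics.adjointDynamics (H : P.FirstOrderDynamics (Icc 0 T) q v l m u)
    (hT : 0 < T) (hu : ContDiffOn ℝ 1 u (Icc 0 T)) (hm : ContinuousOn m (Icc 0 T)) :
    P.AdjointDynamics (Icc 0 T) q l u := by
  have hU := uniqueDiffOn_Icc hT
  have eqv : EqOn (derivWithin q (Icc 0 T)) v (Icc 0 T) := fun t ht =>
    (H.deriv_q t ht).derivWithin (hU t ht)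
  have eqm : EqOn (derivWithin l (Icc 0 T)) m (Icc 0 T) := fun t ht =>
    (H.deriv_l t ht).derivWithin (hU t ht)
  have hs := H.stateDynamics hT hu
  have hq1 : ContDiffOn ℝ 1 q (Icc 0 T) := hs.1.of_le (by norm_num)
  have hv1 : ContDiffOn ℝ 1 v (Icc 0 T) :=
    ((hs.1.derivWithin hU (m := 1) (by norm_num))).congr fun t ht => (eqv ht).symm
  have hl1 : ContDiffOn ℝ 1 l (Icc 0 T) := contDiffOn_one_of_hasDerivWithinAt hT H.deriv_l hm
  have hlf : ContDiffOn ℝ 1 (fun t => (l t).comp (P.fv (q t) (v t))) (Icc 0 T) :=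
    hl1.clm_comp (P.contDiffOn_fv_comp H.mem hq1 hv1)
  have hp1 : ContDiffOn ℝ 1 (fun s => P.momentum (q s) (v s) (l s) (m s)) (Icc 0 T) :=
    contDiffOn_one_of_hasDerivWithinAt hT H.deriv_momentum (P.continuousOn_force H.mem
      hq1.continuousOn hv1.continuousOn hl1.continuousOn hu.continuousOn)
  have em : ∀ t, m t = P.momentum (q t) (v t) (l t) (m t) - (l t).comp (P.fv (q t) (v t)) :=
    fun t => by simp [momentum]
  have hm1 : ContDiffOn ℝ 1 m (Icc 0 T) := (hp1.sub hlf).congr fun t _ => em t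
  refine ⟨contDiffOn_of_hasDerivWithinAt hT (by simp) one_add_one_eq_two H.deriv_l hm1,
    fun t ht => ?_⟩
  · have h3 := (hlf.differentiableOn one_ne_zero t ht).hasDerivWithinAt
    have e : EqOn (fun s => (l s).comp (fderiv ℝ (P.f (q s)) (derivWithin q (Icc 0 T) s)))
        (fun t => (l t).comp (P.fv (q t) (v t))) (Icc 0 T) := fun s hs => by
      simp only [eqv hs, fv]
    have h1 := ((H.deriv_momentum t ht).sub h3).congr (fun s _ => em s) (em t)
    rw [derivWithin_congr eqm (eqm ht), derivWithin_congr e (e ht), eqv ht,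
      h1.derivWithin (hU t ht), force]
    abel

/-! ### The first variation of the Lagrangian -/

/-- The Lagrangian as a function on the product of its arguments `(q, λ, v, v_λ, u)`. -/
def lagrangianProd (P : ControlProblem E U) (z : E × Covec E × E × Covec E × U) : ℝ :=
  P.lagrangian z.1 z.2.1 z.2.2.1 z.2.2.2.1 z.2.2.2.2

theorem contDiffOn_lagrangianProd (P : ControlProblem E U) :
    ContDiffOn ℝ 1 P.lagrangianProd (P.Q ×ˢ univ) := by
  have hx : ContDiffOn ℝ 1 (fun z : E × Covec E × E × Covec E × U => z.1) (P.Q ×ˢ univ) :=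
    contDiffOn_fst
  have hl : ContDiff ℝ 1 (fun z : E × Covec E × E × Covec E × U => z.2.1) := by fun_prop
  have hv : ContDiff ℝ 1 (fun z : E × Covec E × E × Covec E × U => z.2.2.1) := by fun_prop
  have hm : ContDiff ℝ 1 (fun z : E × Covec E × E × Covec E × U => z.2.2.2.1) := by fun_prop
  have hu : ContDiff ℝ 1 (fun z : E × Covec E × E × Covec E × U => z.2.2.2.2) := by fun_prop
  have hQ : ∀ z ∈ P.Q ×ˢ (univ : Set (Covec E × E × Covec E × U)), z.1 ∈ P.Q := fun z hz => hz.1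
  have hf := P.contDiff_f.comp (hx.prodMk hv.contDiffOn) fun z hz => ⟨hQ z hz, mem_univ _⟩
  have hr := (P.contDiff_rho.comp hx hQ).clm_apply hu.contDiffOn
  have hg := ((P.contDiffOn_g.comp hx hQ).clm_apply hu.contDiffOn).clm_apply hu.contDiffOn
  exact ((hm.clm_apply hv).contDiffOn.add (hl.contDiffOn.clm_apply (hf.add hr))).sub
    (contDiffOn_const.mul hg)

/-- The increments of `λ` and `v_λ` are zero because the adjoint curve will be frozen. Each of the
other partial derivatives is found by differentiating along a slice and comparing by uniqueness of
the derivative. -/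
theorem fderiv_lagrangianProd_apply (P : ControlProblem E U) {x : E} (hx : x ∈ P.Q) (l : Covec E)
    (v : E) (m : Covec E) (w : U) (dx dv : E) (dw : U) :
    fderiv ℝ P.lagrangianProd (x, l, v, m, w) (dx, 0, dv, 0, dw) =
      P.momentum x v l m dv + P.force x v l w dx + (l.comp (P.rho x) - P.g x w) dw := by
  have hO : IsOpen (P.Q ×ˢ (univ : Set (Covec E × E × Covec E × U))) := P.isOpen_Q.prod isOpen_univ
  have hL : HasFDerivAt P.lagrangianProd (fderiv ℝ P.lagrangianProd (x, l, v, m, w))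
      (x, l, v, m, w) :=
    ((P.contDiffOn_lagrangianProd.contDiffAt (hO.mem_nhds ⟨hx, mem_univ _⟩)).differentiableAt
      one_ne_zero).hasFDerivAt
  have hfv : HasFDerivAt (P.f x) (P.fv x v) v := by
    have h1 : HasFDerivAt (fun z : E × E => P.f z.1 z.2) _ (x, v) :=
      ((P.contDiff_f.contDiffAt (P.isOpen_prod_univ.mem_nhds ⟨hx, mem_univ _⟩)).differentiableAt
        one_ne_zero).hasFDerivAt
    have h2 := h1.comp v (f := fun y => (x, y)) (hasFDerivAt_prodMk_right x v)
    exact h2.differentiableAt.hasFDerivAt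
  have e1 : fderiv ℝ P.lagrangianProd (x, l, v, m, w) (dx, 0, 0, 0, 0) =
      P.force x v l w dx := by
    have h1 := hL.comp x (f := fun y => (y, l, v, m, w)) (hasFDerivAt_prodMk_left x _)
    have h2 : HasFDerivAt (fun y => P.lagrangian y l v m w) (P.force x v l w) x :=
      ((((l.hasFDerivAt.comp x (((P.hasFDerivAt_f_fst hx v).differentiableAt.hasFDerivAt).add
        (P.hasFDerivAt_rho_apply hx w).differentiableAt.hasFDerivAt)).const_add (m v))).sub
        ((P.hasFDerivAt_g_apply hx w).differentiableAt.hasFDerivAt.const_mul (1 / 2)))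
    exact DFunLike.congr_fun (h1.unique h2) dx
  have e2 : fderiv ℝ P.lagrangianProd (x, l, v, m, w) (0, 0, dv, 0, 0) =
      P.momentum x v l m dv := by
    have h1 := hL.comp v (f := fun y => (x, l, y, m, w))
      (((hasFDerivAt_const x v).prodMk ((hasFDerivAt_const l v).prodMk ((hasFDerivAt_id v).prodMk
        (hasFDerivAt_const (m, w) v)))))
    have h2 : HasFDerivAt (fun y => P.lagrangian x l y m w) (P.momentum x v l m) v :=
      (m.hasFDerivAt.add (l.hasFDerivAt.comp v (hfv.add_const _))).sub_const _
    exact DFunLike.congr_fun (h1.unique h2) dv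
  have e3 : fderiv ℝ P.lagrangianProd (x, l, v, m, w) (0, 0, 0, 0, dw) =
      (l.comp (P.rho x) - P.g x w) dw := by
    have h1 := hL.comp w (f := fun y => (x, l, v, m, y))
      (((hasFDerivAt_const x w).prodMk ((hasFDerivAt_const l w).prodMk ((hasFDerivAt_const v w).prodMk
        ((hasFDerivAt_const m w).prodMk (hasFDerivAt_id w))))))
    have hg : HasFDerivAt (fun y => (1 / 2 : ℝ) * P.g x y y) (P.g x w) w := by
      have := ((P.g x).hasFDerivAt.clm_apply (hasFDerivAt_id w)).const_mul (1 / 2 : ℝ)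
      refine this.congr_fderiv ?_
      ext d
      -- Symmetry of `g` merges the two halves of the derivative of `½ g(u,u)` into `g u`.
      have hs := P.g_symm hx w d
      simp only [id, smul_apply, add_apply, ContinuousLinearMap.comp_apply, smul_eq_mul,
        ContinuousLinearMap.flip_apply, ContinuousLinearMap.id_apply]
      rw [← hs]
      ring
    have h2 : HasFDerivAt (fun y => P.lagrangian x l v m y) (l.comp (P.rho x) - P.g x w) w :=
      ((l.hasFDerivAt.comp w ((P.rho x).hasFDerivAt.const_add _)).const_add _).sub hg
    exact DFunLike.congr_fun (h1.unique h2) dw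
  have e : ((dx, 0, dv, 0, dw) : E × Covec E × E × Covec E × U) =
      (0, 0, dv, 0, 0) + (dx, 0, 0, 0, 0) + (0, 0, 0, 0, dw) := by simp
  rw [e, map_add, map_add, e1, e2, e3]

/-! ### The exact discrete Lagrangian -/

variable {h : ℝ} {D : Set (E × E × C1Curve h U)} {V : Set (C1Curve h E)}

theorem WellPosed.stateSol_spec (hwp : P.WellPosed h D V) {d : E × E × C1Curve h U} (hd : d ∈ D) :
    P.stateSol V d ∈ V ∧ P.StateBVP d.1 d.2.1 d.2.2 (P.stateSol V d) := by
  have hex := (hwp.state_unique d hd).exists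
  rw [stateSol, dif_pos hex]
  exact hex.choose_spec

theorem WellPosed.stateSol_eq (hwp : P.WellPosed h D V) {d : E × E × C1Curve h U} (hd : d ∈ D)
    {c : C1Curve h E} (hc : c ∈ V) (hc' : P.StateBVP d.1 d.2.1 d.2.2 c) : P.stateSol V d = c :=
  (hwp.state_unique d hd).unique (hwp.stateSol_spec hd) ⟨hc, hc'⟩

theorem WellPosed.adjointSol_spec (hwp : P.WellPosed h D V) {d : E × E × C1Curve h U} (hd : d ∈ D)
    (la lb : Covec E) :
    P.AdjointBVP (P.stateSol V d) d.2.2 la lb (P.adjointSol V d la lb) := by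
  have hex := (hwp.adjoint_unique d hd la lb).exists
  rw [adjointSol, dif_pos hex]
  exact hex.choose_spec

theorem WellPosed.adjointSol_eq (hwp : P.WellPosed h D V) {d : E × E × C1Curve h U} (hd : d ∈ D)
    {la lb : Covec E} {l : C1Curve h (Covec E)}
    (hl : P.AdjointBVP (P.stateSol V d) d.2.2 la lb l) : P.adjointSol V d la lb = l :=
  (hwp.adjoint_unique d hd la lb).unique (hwp.adjointSol_spec hd la lb) hl

theorem WellPosed.firstOrderDynamics (hwp : P.WellPosed h D V) (hh : 0 < h)
    {d : E × E × C1Curve h U} (hd : d ∈ D) (la lb : Covec E) :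
    P.FirstOrderDynamics (Icc 0 h) (posAt (P.stateSol V d)) (velAt (P.stateSol V d))
      (posAt (P.adjointSol V d la lb)) (velAt (P.adjointSol V d la lb)) (posAt d.2.2) :=
  .of_dynamics hh (fun _ => hasDerivWithinAt_posAt _) (fun _ => hasDerivWithinAt_posAt _)
    (hwp.stateSol_spec hd).2.1 (hwp.adjointSol_spec hd la lb).1

/-- The action `∫₀ʰ L` along given curves. -/
def action (P : ControlProblem E U) (c : C1Curve h E) (l : C1Curve h (Covec E))
    (w : C1Curve h U) : ℝ :=
  ∫ t in (0 : ℝ)..h, P.lagrangian (posAt c t) (posAt l t) (velAt c t) (velAt l t) (posAt w t)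

theorem continuousOn_lagrangian_comp {c : C1Curve h E} (l : C1Curve h (Covec E)) (w : C1Curve h U)
    (hc : ∀ t ∈ Icc 0 h, posAt c t ∈ P.Q) : ContinuousOn (fun t =>
      P.lagrangian (posAt c t) (posAt l t) (velAt c t) (velAt l t) (posAt w t)) (Icc 0 h) :=
  P.contDiffOn_lagrangianProd.continuousOn.comp ((continuousOn_posAt c).prodMk
    ((continuousOn_posAt l).prodMk ((continuousOn_velAt c).prodMk ((continuousOn_velAt l).prodMk
      (continuousOn_posAt w))))) fun t ht => ⟨hc t ht, mem_univ _⟩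

theorem hasDerivAt_of_mem_Ioo {F : Type*} [NormedAddCommGroup F] [NormedSpace ℝ F] {x : ℝ → F}
    {x' : F} {a b t : ℝ} (ht : t ∈ Ioo a b) (hx : HasDerivWithinAt x x' (Icc a b) t) :
    HasDerivAt x x' t :=
  hx.hasDerivAt (Icc_mem_nhds ht.1 ht.2)

/-- On state curves, the action depends on the adjoint curve only through its end points. -/
theorem action_sub_action (hh : 0 < h) {c : C1Curve h E} {w : C1Curve h U}
    (hc : P.StateDynamics (Icc 0 h) (posAt c) (posAt w)) (l l' : C1Curve h (Covec E)) :
    P.action c l w - P.action c l' w =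
      (posAt l h - posAt l' h) (velAt c h) - (posAt l 0 - posAt l' 0) (velAt c 0) := by
  have hU := uniqueDiffOn_Icc hh
  have hQ : ∀ t ∈ Icc 0 h, posAt c t ∈ P.Q := fun t ht => (hc.2 t ht).1
  have eqv : EqOn (derivWithin (posAt c) (Icc 0 h)) (velAt c) (Icc 0 h) := fun t ht =>
    (hasDerivWithinAt_posAt c ht).derivWithin (hU t ht)
  have hv1 : ContDiffOn ℝ 1 (velAt c) (Icc 0 h) :=
    ((hc.1.derivWithin hU (m := 1) (by norm_num))).congr fun t ht => (eqv ht).symm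
  have hv : ∀ t ∈ Icc 0 h, HasDerivWithinAt (velAt c)
      (P.f (posAt c t) (velAt c t) + P.rho (posAt c t) (posAt w t)) (Icc 0 h) t := fun t ht => by
    have h1 := (hv1.differentiableOn one_ne_zero t ht).hasDerivWithinAt
    have h2 := (hc.2 t ht).2
    rw [derivWithin_congr eqv (eqv ht), eqv ht] at h2
    rwa [h2] at h1
  have hi := fun l : C1Curve h (Covec E) =>
    (continuousOn_lagrangian_comp l w hQ).intervalIntegrable_of_Icc (μ := volume) hh.le
  -- The control costs cancel, and since `q̈ = f + ρ u` the difference of the integrands is exactly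
  -- the derivative of `(λ - λ')ᵀ q̇`.
  rw [action, action, ← intervalIntegral.integral_sub (hi l) (hi l'),
    ← intervalIntegral.integral_eq_sub_of_hasDerivAt_of_le (f := fun t =>
      (posAt l t - posAt l' t) (velAt c t)) hh.le
      (((continuousOn_posAt l).sub (continuousOn_posAt l')).clm_apply (continuousOn_velAt c))
      (fun t ht => ?_) ((hi l).sub (hi l'))]
  have ht' := Ioo_subset_Icc_self ht
  refine hasDerivAt_of_mem_Ioo ht (((((hasDerivWithinAt_posAt l ht').sub
    (hasDerivWithinAt_posAt l' ht')).clm_apply (hv t ht'))).congr_deriv ?_)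
  simp only [lagrangian, sub_apply, Pi.sub_apply]
  ring

/-- State curve and control vary independently here, with no dynamics imposed on them; the adjoint
curve is frozen. -/
theorem exists_hasFDerivAt_action (hh : 0 ≤ h) {c : C1Curve h E} (l : C1Curve h (Covec E))
    {w : C1Curve h U} (hc : ∀ t ∈ Icc 0 h, posAt c t ∈ P.Q) :
    ∃ A : C1Curve h E × C1Curve h U →L[ℝ] ℝ,
      HasFDerivAt (fun x : C1Curve h E × C1Curve h U => P.action x.1 l x.2) A (c, w) ∧
      ∀ dc dw, A (dc, dw) = ∫ t in (0 : ℝ)..h,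
        (P.momentum (posAt c t) (velAt c t) (posAt l t) (velAt l t) (velAt dc t)
        + P.force (posAt c t) (velAt c t) (posAt l t) (posAt w t) (posAt dc t)
        + ((posAt l t).comp (P.rho (posAt c t)) - P.g (posAt c t) (posAt w t)) (posAt dw t)) := by
  let ev : ℝ → (C1Curve h E × C1Curve h (Covec E) × C1Curve h U) →L[ℝ]
      (E × Covec E × E × Covec E × U) := fun t =>
    ((posCLM t).comp (.fst ℝ _ _)).prod
      (((posCLM t).comp ((ContinuousLinearMap.fst ℝ _ _).comp (.snd ℝ _ _))).prod
        (((velCLM t).comp (.fst ℝ _ _)).prod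
          (((velCLM t).comp ((ContinuousLinearMap.fst ℝ _ _).comp (.snd ℝ _ _))).prod
            ((posCLM t).comp ((ContinuousLinearMap.snd ℝ _ _).comp (.snd ℝ _ _))))))
  have hev : ∀ t x, ev t x = (posAt x.1 t, posAt x.2.1 t, velAt x.1 t, velAt x.2.1 t,
    posAt x.2.2 t) := fun t x => rfl
  obtain ⟨A, hA, hA'⟩ := exists_hasFDerivAt_integral_comp (P.isOpen_Q.prod isOpen_univ)
    P.contDiffOn_lagrangianProd hh ev (fun t _ x => by
      have h1 := norm_fst_le x
      have h2 := (norm_fst_le x.2).trans (norm_snd_le x)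
      have h3 := (norm_snd_le x.2).trans (norm_snd_le x)
      rw [hev]
      simp only [Prod.norm_def (E := E), Prod.norm_def (E := Covec E), sup_le_iff]
      exact ⟨(norm_posAt_le _ _).trans h1, (norm_posAt_le _ _).trans h2,
        (norm_velAt_le _ _).trans h1, (norm_velAt_le _ _).trans h2, (norm_posAt_le _ _).trans h3⟩)
    (fun x => (continuousOn_posAt _).prodMk ((continuousOn_posAt _).prodMk
      ((continuousOn_velAt _).prodMk ((continuousOn_velAt _).prodMk (continuousOn_posAt _)))))
    (x₀ := (c, l, w)) (fun t ht => ⟨hc t ht, mem_univ _⟩)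
  refine ⟨_, hA.comp (c, w) (f := fun x : C1Curve h E × C1Curve h U => (x.1, l, x.2))
    (hasFDerivAt_fst.prodMk ((hasFDerivAt_const l _).prodMk hasFDerivAt_snd)), fun dc dw => ?_⟩
  refine (hA' (dc, 0, dw)).trans (intervalIntegral.integral_congr fun t ht => ?_)
  rw [uIcc_of_le hh] at ht
  have e0 : ev t (dc, 0, dw) = (posAt dc t, 0, velAt dc t, 0, posAt dw t) := by
    rw [hev]
    simp only [← posCLM_apply, ← velCLM_apply, map_zero]
  rw [e0, hev]
  exact P.fderiv_lagrangianProd_apply (hc t ht) _ _ _ _ _ _ _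

/-- `(λ̇ + (∂f/∂q̇)ᵀ λ)ᵀ` at time `s` along the curves of the exact discrete Lagrangian. -/
def segMomentum (P : ControlProblem E U) (V : Set (C1Curve h E)) (y y' : E × Covec E)
    (w : C1Curve h U) (s : ℝ) : Covec E :=
  P.momentum (posAt (P.stateSol V (y.1, y'.1, w)) s) (velAt (P.stateSol V (y.1, y'.1, w)) s)
    (posAt (P.adjointSol V (y.1, y'.1, w) y.2 y'.2) s)
    (velAt (P.adjointSol V (y.1, y'.1, w) y.2 y'.2) s)

/-- The residual `(ρ(q)ᵀ λ - g(q) u)ᵀ` at time `s` along the curves of the exact discrete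
Lagrangian. -/
def segResidual (P : ControlProblem E U) (V : Set (C1Curve h E)) (y y' : E × Covec E)
    (w : C1Curve h U) (s : ℝ) : Covec U :=
  (posAt (P.adjointSol V (y.1, y'.1, w) y.2 y'.2) s).comp
      (P.rho (posAt (P.stateSol V (y.1, y'.1, w)) s))
    - P.g (posAt (P.stateSol V (y.1, y'.1, w)) s) (posAt w s)

/-- This regularity allows the residual to serve as its own test curve in
`eqOn_zero_of_integral_apply_eq_zero`. -/
theorem WellPosed.contDiffOn_segResidual (hwp : P.WellPosed h D V) (hh : 0 < h)
    {y y' : E × Covec E} {w : C1Curve h U} (hd : (y.1, y'.1, w) ∈ D) :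
    ContDiffOn ℝ 1 (P.segResidual V y y' w) (Icc 0 h) := by
  have H := hwp.firstOrderDynamics hh hd y.2 y'.2
  have hc := contDiffOn_posAt hh (P.stateSol V (y.1, y'.1, w))
  exact ((contDiffOn_posAt hh _).clm_comp (P.contDiff_rho.comp hc H.mem)).sub
    ((P.contDiffOn_g.comp hc H.mem).clm_apply (contDiffOn_posAt hh w))

/-- Integration by parts: `ṗ` is the force, so the integrand is `d/dt (p δq)`. Integrability is
recorded as well, so that the residual term can be split off later. -/
theorem FirstOrderDynamics.integral_momentum_add_force (hh : 0 < h) {q v : ℝ → E}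
    {l m : ℝ → Covec E} {u : ℝ → U} (H : P.FirstOrderDynamics (Icc 0 h) q v l m u)
    (hu : ContinuousOn u (Icc 0 h)) (dc : C1Curve h E) :
    IntervalIntegrable (fun t => P.momentum (q t) (v t) (l t) (m t) (velAt dc t)
      + P.force (q t) (v t) (l t) (u t) (posAt dc t)) volume 0 h ∧
    ∫ t in (0 : ℝ)..h, (P.momentum (q t) (v t) (l t) (m t) (velAt dc t)
      + P.force (q t) (v t) (l t) (u t) (posAt dc t)) =
    P.momentum (q h) (v h) (l h) (m h) (posAt dc h)
      - P.momentum (q 0) (v 0) (l 0) (m 0) (posAt dc 0) := by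
  have hp : ContinuousOn (fun t => P.momentum (q t) (v t) (l t) (m t)) (Icc 0 h) :=
    fun t ht => (H.deriv_momentum t ht).continuousWithinAt
  have hf : ContinuousOn (fun t => P.force (q t) (v t) (l t) (u t)) (Icc 0 h) :=
    P.continuousOn_force H.mem (fun t ht => (H.deriv_q t ht).continuousWithinAt)
      (fun t ht => (H.deriv_v t ht).continuousWithinAt)
      (fun t ht => (H.deriv_l t ht).continuousWithinAt) hu
  have hint : IntervalIntegrable (fun t => P.momentum (q t) (v t) (l t) (m t) (velAt dc t)
      + P.force (q t) (v t) (l t) (u t) (posAt dc t)) volume 0 h :=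
    ContinuousOn.intervalIntegrable_of_Icc hh.le
      ((hp.clm_apply (continuousOn_velAt dc)).add (hf.clm_apply (continuousOn_posAt dc)))
  refine ⟨hint, intervalIntegral.integral_eq_sub_of_hasDerivAt_of_le hh.le
    (hp.clm_apply (continuousOn_posAt dc)) (fun t ht => ?_) hint⟩
  have ht' := Ioo_subset_Icc_self ht
  refine hasDerivAt_of_mem_Ioo ht (((H.deriv_momentum t ht').clm_apply
    (hasDerivWithinAt_posAt dc ht')).congr_deriv ?_)
  rw [add_comm]

/-- The first variation of the exact discrete Lagrangian. -/
theorem WellPosed.exists_hasFDerivAt_exactLagrangian (hwp : P.WellPosed h D V) (hh : 0 < h)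
    {y y' : E × Covec E} {w : C1Curve h U} (hd : (y.1, y'.1, w) ∈ D) :
    ∃ A : (E × Covec E) × (E × Covec E) × C1Curve h U →L[ℝ] ℝ,
      HasFDerivAt (fun x : (E × Covec E) × (E × Covec E) × C1Curve h U =>
        P.exactLagrangian V x.1 x.2.1 x.2.2) A (y, y', w) ∧
      ∀ dy dy' dw, A (dy, dy', dw) =
        dy'.2 (P.velPlus V y.1 y'.1 w) - dy.2 (P.velMinus V y.1 y'.1 w)
        + P.segMomentum V y y' w h dy'.1 - P.segMomentum V y y' w 0 dy.1
        + ∫ t in (0 : ℝ)..h, P.segResidual V y y' w t (posAt dw t) := by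
  set c := P.stateSol V (y.1, y'.1, w) with hc
  set l := P.adjointSol V (y.1, y'.1, w) y.2 y'.2 with hl
  have H := hwp.firstOrderDynamics hh hd y.2 y'.2
  rw [← hc, ← hl] at H
  obtain ⟨A, hA, hA'⟩ := P.exists_hasFDerivAt_action hh.le l (c := c) (w := w) H.mem
  let π : (E × Covec E) × (E × Covec E) × C1Curve h U →L[ℝ] E × E × C1Curve h U :=
    ((ContinuousLinearMap.fst ℝ E (Covec E)).comp (.fst ℝ _ _)).prod
      (((ContinuousLinearMap.fst ℝ E (Covec E)).comp
        ((ContinuousLinearMap.fst ℝ _ _).comp (.snd ℝ _ _))).prod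
        ((ContinuousLinearMap.snd ℝ _ _).comp (.snd ℝ _ _)))
  have hπ : ∀ x, π x = (x.1.1, x.2.1.1, x.2.2) := fun x => rfl
  have hK : HasFDerivAt (P.stateSol V) (fderiv ℝ (P.stateSol V) (π (y, y', w))) (π (y, y', w)) :=
    (hwp.differentiable.differentiableAt (hwp.isOpen_D.mem_nhds hd)).hasFDerivAt
  set K := fderiv ℝ (P.stateSol V) (π (y, y', w))
  have hDn : ∀ᶠ d in 𝓝 (π (y, y', w)), d ∈ D := hwp.isOpen_D.mem_nhds hd
  -- Differentiating the boundary conditions `q(0) = a`, `q(h) = b`, valid throughout the open set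
  -- `D`, gives the end values of the varied state curve.
  have hK0 : ∀ d, posAt (K d) 0 = d.1 := by
    have h1 := (posCLM (F := E) (h := h) 0).hasFDerivAt.comp _ hK
    have h2 : HasFDerivAt (fun d : E × E × C1Curve h U => d.1) _ (π (y, y', w)) :=
      h1.congr_of_eventuallyEq (hDn.mono fun d hd => ((hwp.stateSol_spec hd).2.2.1).symm)
    exact fun d => DFunLike.congr_fun (h2.unique hasFDerivAt_fst) d
  have hKh : ∀ d, posAt (K d) h = d.2.1 := by
    have h1 := (posCLM (F := E) (h := h) h).hasFDerivAt.comp _ hK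
    have h2 : HasFDerivAt (fun d : E × E × C1Curve h U => d.2.1) _ (π (y, y', w)) :=
      h1.congr_of_eventuallyEq (hDn.mono fun d hd => ((hwp.stateSol_spec hd).2.2.2).symm)
    exact fun d => DFunLike.congr_fun (h2.unique
      ((ContinuousLinearMap.fst ℝ E (C1Curve h U)).comp (.snd ℝ E _)).hasFDerivAt) d
  have hS : HasFDerivAt (fun x => P.stateSol V (π x)) (K.comp π) (y, y', w) :=
    hK.comp _ π.hasFDerivAt
  have hw : HasFDerivAt (fun x : (E × Covec E) × (E × Covec E) × C1Curve h U => x.2.2) _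
    (y, y', w) := ((ContinuousLinearMap.snd ℝ (E × Covec E) (C1Curve h U)).comp
      (.snd ℝ (E × Covec E) _)).hasFDerivAt
  have hla : HasFDerivAt (fun x : (E × Covec E) × (E × Covec E) × C1Curve h U => x.1.2 - y.2) _
    (y, y', w) := ((ContinuousLinearMap.snd ℝ E (Covec E)).comp
      (.fst ℝ (E × Covec E) ((E × Covec E) × C1Curve h U))).hasFDerivAt.sub_const y.2
  have hlb : HasFDerivAt (fun x : (E × Covec E) × (E × Covec E) × C1Curve h U => x.2.1.2 - y'.2) _
    (y, y', w) := ((ContinuousLinearMap.snd ℝ E (Covec E)).comp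
      ((ContinuousLinearMap.fst ℝ (E × Covec E) (C1Curve h U)).comp
        (.snd ℝ (E × Covec E) _))).hasFDerivAt.sub_const y'.2
  have hact := hA.comp (y, y', w)
    (f := fun x : (E × Covec E) × (E × Covec E) × C1Curve h U => (P.stateSol V (π x), x.2.2))
    (hS.prodMk hw)
  have hv0 := (velCLM (F := E) (h := h) 0).hasFDerivAt.comp _ hS
  have hvh := (velCLM (F := E) (h := h) h).hasFDerivAt.comp _ hS
  -- The adjoint increments vanish at the base point, so the product rule leaves only the values of
  -- the end velocities, not their derivatives.
  have htot := (hact.add (hlb.clm_apply hvh)).sub (hla.clm_apply hv0)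
  refine ⟨_, htot.congr_of_eventuallyEq ?_, fun dy dy' dw => ?_⟩
  -- For nearby data the true adjoint curve is exchanged for the frozen `l`; no differentiability of
  -- the adjoint solution is needed.
  · filter_upwards [π.continuous.continuousAt.eventually hDn] with x hx
    have h1 := action_sub_action hh (hwp.stateSol_spec hx).2.1
      (P.adjointSol V (π x) x.1.2 x.2.1.2) l
    rw [(hwp.adjointSol_spec hx _ _).2.1, (hwp.adjointSol_spec hx _ _).2.2,
      (hwp.adjointSol_spec hd _ _).2.1, (hwp.adjointSol_spec hd _ _).2.2] at h1
    have h2 : P.exactLagrangian V x.1 x.2.1 x.2.2 =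
      P.action (P.stateSol V (π x)) (P.adjointSol V (π x) x.1.2 x.2.1.2) x.2.2 := rfl
    have h3 : (π x).2.2 = x.2.2 := rfl
    rw [h2, ← h3, eq_add_of_sub_eq' h1]
    simp [hπ]
    ring
  · have h1 : A (K (dy.1, dy'.1, dw), dw) = P.segMomentum V y y' w h dy'.1
        - P.segMomentum V y y' w 0 dy.1
        + ∫ t in (0 : ℝ)..h, P.segResidual V y y' w t (posAt dw t) := by
      obtain ⟨hi, he⟩ := H.integral_momentum_add_force hh (continuousOn_posAt w)
        (K (dy.1, dy'.1, dw))
      rw [hA', intervalIntegral.integral_add hi, he, hK0, hKh]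
      · rfl
      · exact ContinuousOn.intervalIntegrable_of_Icc hh.le
          ((hwp.contDiffOn_segResidual hh hd).continuousOn.clm_apply (continuousOn_posAt dw))
    simp [h1, hπ, velPlus, velMinus, ← hc]
    ring

@[simp] theorem _root_.posAt_zero {F : Type*} [NormedAddCommGroup F] [NormedSpace ℝ F] (s : ℝ) :
    posAt (0 : C1Curve h F) s = 0 := map_zero (posCLM s)

/-! ### Partial derivatives -/

/-- The derivative of the exact discrete Lagrangian in all its arguments. -/
def DL (P : ControlProblem E U) (V : Set (C1Curve h E)) (y y' : E × Covec E) (w : C1Curve h U) :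
    (E × Covec E) × (E × Covec E) × C1Curve h U →L[ℝ] ℝ :=
  fderiv ℝ (fun x : (E × Covec E) × (E × Covec E) × C1Curve h U =>
    P.exactLagrangian V x.1 x.2.1 x.2.2) (y, y', w)

/-- The derivative of the velocity at time `s` of the state curve in all its arguments. -/
def DVel (P : ControlProblem E U) (V : Set (C1Curve h E)) (s : ℝ) (d : E × E × C1Curve h U) :
    E × E × C1Curve h U →L[ℝ] E :=
  (velCLM s).comp (fderiv ℝ (P.stateSol V) d)

section Lagrangian

variable (hwp : P.WellPosed h D V) (hh : 0 < h) {y y' : E × Covec E} {w : C1Curve h U}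
  (hd : (y.1, y'.1, w) ∈ D)

include hwp hh hd

theorem WellPosed.hasFDerivAt_exactLagrangian :
    HasFDerivAt (fun x : (E × Covec E) × (E × Covec E) × C1Curve h U =>
      P.exactLagrangian V x.1 x.2.1 x.2.2) (P.DL V y y' w) (y, y', w) := by
  obtain ⟨A, hA, -⟩ := hwp.exists_hasFDerivAt_exactLagrangian hh hd
  exact hA.differentiableAt.hasFDerivAt

theorem WellPosed.DL_apply (dy dy' : E × Covec E) (dw : C1Curve h U) :
    P.DL V y y' w (dy, dy', dw) =
      dy'.2 (P.velPlus V y.1 y'.1 w) - dy.2 (P.velMinus V y.1 y'.1 w)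
      + P.segMomentum V y y' w h dy'.1 - P.segMomentum V y y' w 0 dy.1
      + ∫ t in (0 : ℝ)..h, P.segResidual V y y' w t (posAt dw t) := by
  obtain ⟨A, hA, hA'⟩ := hwp.exists_hasFDerivAt_exactLagrangian hh hd
  rw [DL, hA.fderiv, hA']

theorem WellPosed.hasFDerivAt_exactLagrangian_left :
    HasFDerivAt (fun x => P.exactLagrangian V x y' w)
      ((P.DL V y y' w).comp (.inl ℝ _ _)) y :=
  (hwp.hasFDerivAt_exactLagrangian hh hd).comp y (f := fun x => (x, y', w))
    (hasFDerivAt_prodMk_left _ _)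

theorem WellPosed.hasFDerivAt_exactLagrangian_right :
    HasFDerivAt (fun x => P.exactLagrangian V y x w)
      ((P.DL V y y' w).comp ((ContinuousLinearMap.inr ℝ _ _).comp (.inl ℝ _ _))) y' :=
  (hwp.hasFDerivAt_exactLagrangian hh hd).comp y' (f := fun x => (y, x, w))
    ((hasFDerivAt_prodMk_right y (y', w)).comp y' (hasFDerivAt_prodMk_left y' w))

theorem WellPosed.hasFDerivAt_exactLagrangian_control :
    HasFDerivAt (fun x => P.exactLagrangian V y y' x)
      ((P.DL V y y' w).comp ((ContinuousLinearMap.inr ℝ _ _).comp (.inr ℝ _ _))) w :=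
  (hwp.hasFDerivAt_exactLagrangian hh hd).comp w (f := fun x => (y, y', x))
    ((hasFDerivAt_prodMk_right y (y', w)).comp w (hasFDerivAt_prodMk_right y' w))

theorem WellPosed.D1L_apply (dy : E × Covec E) :
    P.D1L V y y' w dy = P.DL V y y' w (dy, 0, 0) := by
  rw [D1L, (hwp.hasFDerivAt_exactLagrangian_left hh hd).fderiv]
  rfl

theorem WellPosed.D2L_apply (dy : E × Covec E) :
    P.D2L V y y' w dy = P.DL V y y' w (0, dy, 0) := by
  rw [D2L, (hwp.hasFDerivAt_exactLagrangian_right hh hd).fderiv]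
  rfl

theorem WellPosed.D3L_apply (dw : C1Curve h U) :
    P.D3L V y y' w dw = P.DL V y y' w (0, 0, dw) := by
  rw [D3L, (hwp.hasFDerivAt_exactLagrangian_control hh hd).fderiv]
  rfl

theorem WellPosed.DL_eq_add (dy dy' : E × Covec E) (dw : C1Curve h U) :
    P.DL V y y' w (dy, dy', dw) = P.D1L V y y' w dy + P.D2L V y y' w dy' + P.D3L V y y' w dw := by
  rw [hwp.D1L_apply hh hd, hwp.D2L_apply hh hd, hwp.D3L_apply hh hd, ← map_add, ← map_add]
  simp

theorem WellPosed.fderiv_exactLagrangian_left_fst (a : E) :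
    fderiv ℝ (fun x => P.exactLagrangian V (x, y.2) y' w) y.1 a = P.D1L V y y' w (a, 0) := by
  have h1 := (hwp.hasFDerivAt_exactLagrangian_left hh hd).comp y.1 (f := fun x => (x, y.2))
    (hasFDerivAt_prodMk_left _ _)
  rw [hwp.D1L_apply hh hd]
  exact DFunLike.congr_fun (HasFDerivAt.fderiv h1) a

theorem WellPosed.fderiv_exactLagrangian_right_fst (b : E) :
    fderiv ℝ (fun x => P.exactLagrangian V y (x, y'.2) w) y'.1 b = P.D2L V y y' w (b, 0) := by
  have h1 := (hwp.hasFDerivAt_exactLagrangian_right hh hd).comp y'.1 (f := fun x => (x, y'.2))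
    (hasFDerivAt_prodMk_left _ _)
  rw [hwp.D2L_apply hh hd]
  exact DFunLike.congr_fun (HasFDerivAt.fderiv h1) b

/-- In the first variation a pure `δλ_k` meets only the boundary term with the initial velocity. -/
theorem WellPosed.hasFDerivAt_exactLagrangian_left_snd :
    HasFDerivAt (fun l => P.exactLagrangian V (y.1, l) y' w)
      (-(ContinuousLinearMap.apply ℝ ℝ (P.velMinus V y.1 y'.1 w))) y.2 := by
  have h1 := (hwp.hasFDerivAt_exactLagrangian_left hh hd).comp y.2 (f := fun x => (y.1, x))
    (hasFDerivAt_prodMk_right _ _)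
  refine HasFDerivAt.congr_fderiv h1 ?_
  ext l
  exact (hwp.DL_apply hh hd (0, l) 0 0).trans (by simp)

theorem WellPosed.hasFDerivAt_exactLagrangian_right_snd :
    HasFDerivAt (fun l => P.exactLagrangian V y (y'.1, l) w)
      (ContinuousLinearMap.apply ℝ ℝ (P.velPlus V y.1 y'.1 w)) y'.2 := by
  have h1 := (hwp.hasFDerivAt_exactLagrangian_right hh hd).comp y'.2 (f := fun x => (y'.1, x))
    (hasFDerivAt_prodMk_right _ _)
  refine HasFDerivAt.congr_fderiv h1 ?_
  ext l
  have := hwp.DL_apply hh hd 0 (0, l) 0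
  simpa using this

end Lagrangian

/-! ### Partial derivatives of the end velocities. -/

section Velocity

variable (hwp : P.WellPosed h D V) {a b : E} {w : C1Curve h U} (hd : (a, b, w) ∈ D)

include hwp

theorem WellPosed.hasFDerivAt_velAt {d : E × E × C1Curve h U} (hd : d ∈ D) (s : ℝ) :
    HasFDerivAt (fun d => velAt (P.stateSol V d) s) (P.DVel V s d) d :=
  (velCLM s).hasFDerivAt.comp d
    (hwp.differentiable.differentiableAt (hwp.isOpen_D.mem_nhds hd)).hasFDerivAt

include hd

theorem WellPosed.fderiv_velAt_left (s : ℝ) (da : E) :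
    fderiv ℝ (fun x => velAt (P.stateSol V (x, b, w)) s) a da = P.DVel V s (a, b, w) (da, 0, 0) := by
  have h1 := (hwp.hasFDerivAt_velAt hd s).comp a (f := fun x => (x, b, w))
    (hasFDerivAt_prodMk_left _ _)
  exact DFunLike.congr_fun (HasFDerivAt.fderiv h1) da

theorem WellPosed.fderiv_velAt_right (s : ℝ) (db : E) :
    fderiv ℝ (fun x => velAt (P.stateSol V (a, x, w)) s) b db = P.DVel V s (a, b, w) (0, db, 0) := by
  have h1 := (hwp.hasFDerivAt_velAt hd s).comp b (f := fun x => (a, x, w))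
    ((hasFDerivAt_prodMk_right a (b, w)).comp b (hasFDerivAt_prodMk_left b w))
  exact DFunLike.congr_fun (HasFDerivAt.fderiv h1) db

theorem WellPosed.fderiv_velAt_control (s : ℝ) (dw : C1Curve h U) :
    fderiv ℝ (fun x => velAt (P.stateSol V (a, b, x)) s) w dw = P.DVel V s (a, b, w) (0, 0, dw) := by
  have h1 := (hwp.hasFDerivAt_velAt hd s).comp w (f := fun x => (a, b, x))
    ((hasFDerivAt_prodMk_right a (b, w)).comp w (hasFDerivAt_prodMk_right b w))
  exact DFunLike.congr_fun (HasFDerivAt.fderiv h1) dw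

theorem WellPosed.fderiv_velAt_left_node (s : ℝ) (l : Covec E) (dy : E × Covec E) :
    fderiv ℝ (fun x : E × Covec E => velAt (P.stateSol V (x.1, b, w)) s) (a, l) dy =
      P.DVel V s (a, b, w) (dy.1, 0, 0) := by
  have h1 := (hwp.hasFDerivAt_velAt hd s).comp (a, l) (f := fun x : E × Covec E => (x.1, b, w))
    (hasFDerivAt_fst.prodMk (hasFDerivAt_const (b, w) _))
  exact DFunLike.congr_fun (HasFDerivAt.fderiv h1) dy

theorem WellPosed.fderiv_velAt_right_node (s : ℝ) (l : Covec E) (dy : E × Covec E) :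
    fderiv ℝ (fun x : E × Covec E => velAt (P.stateSol V (a, x.1, w)) s) (b, l) dy =
      P.DVel V s (a, b, w) (0, dy.1, 0) := by
  have h1 := (hwp.hasFDerivAt_velAt hd s).comp (b, l) (f := fun x : E × Covec E => (a, x.1, w))
    ((hasFDerivAt_const a _).prodMk (hasFDerivAt_fst.prodMk (hasFDerivAt_const w _)))
  exact DFunLike.congr_fun (HasFDerivAt.fderiv h1) dy

end Velocity

/-! ### The first variation of the discrete objective -/

section Objective

variable {N : ℕ}

/-- `node · k` as a continuous linear map. -/
def nodeCLM (E U : Type*) [NormedAddCommGroup E] [NormedSpace ℝ E] [NormedAddCommGroup U]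
    [NormedSpace ℝ U] (h : ℝ) (N k : ℕ) : DiscreteVars E U h N →L[ℝ] E × Covec E :=
  if hk : k < N + 1 then
    (ContinuousLinearMap.proj (⟨k, hk⟩ : Fin (N + 1))).comp (.fst ℝ (Fin (N + 1) → E × Covec E) _)
  else 0

/-- `ctrl · k` as a continuous linear map. -/
def ctrlCLM (E U : Type*) [NormedAddCommGroup E] [NormedSpace ℝ E] [NormedAddCommGroup U]
    [NormedSpace ℝ U] (h : ℝ) (N k : ℕ) : DiscreteVars E U h N →L[ℝ] C1Curve h U :=
  if hk : k < N then
    (ContinuousLinearMap.proj (⟨k, hk⟩ : Fin N)).comp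
      ((ContinuousLinearMap.fst ℝ (Fin N → C1Curve h U) _).comp
        (.snd ℝ (Fin (N + 1) → E × Covec E) _))
  else 0

@[simp] theorem nodeCLM_apply (k : ℕ) (z : DiscreteVars E U h N) :
    nodeCLM E U h N k z = node z k := by
  unfold nodeCLM node
  split_ifs <;> rfl

@[simp] theorem ctrlCLM_apply (k : ℕ) (z : DiscreteVars E U h N) :
    ctrlCLM E U h N k z = ctrl z k := by
  unfold ctrlCLM ctrl
  split_ifs <;> rfl

theorem hasFDerivAt_node (k : ℕ) (z : DiscreteVars E U h N) :
    HasFDerivAt (fun z => node z k) (nodeCLM E U h N k) z :=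
  (funext (nodeCLM_apply k) : ⇑(nodeCLM E U h N k) = fun z => node z k) ▸
    (nodeCLM E U h N k).hasFDerivAt

theorem hasFDerivAt_ctrl (k : ℕ) (z : DiscreteVars E U h N) :
    HasFDerivAt (fun z => ctrl z k) (ctrlCLM E U h N k) z :=
  (funext (ctrlCLM_apply k) : ⇑(ctrlCLM E U h N k) = fun z => ctrl z k) ▸
    (ctrlCLM E U h N k).hasFDerivAt

/-- The first variation of the discrete objective at `z` in the direction `(dy, du, dμ, dν)`. -/
def variation (P : ControlProblem E U) (V : Set (C1Curve h E)) (z : DiscreteVars E U h (N + 1))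
    (dy : ℕ → E × Covec E) (du : ℕ → C1Curve h U) (dm dn : Covec E) : ℝ :=
  fderiv ℝ (fun x => P.phi x (P.finalVel V z)) (node z (N + 1)).1 (dy (N + 1)).1
    + P.endDefect V z (P.DVel V h (segData z N) ((dy N).1, (dy (N + 1)).1, du N))
    + (dy (N + 1)).2 (P.finalVel V z) - (dy 0).2 (P.initVel V z)
    + startDefect z (P.DVel V 0 (segData z 0) ((dy 0).1, (dy 1).1, du 0))
    + dm ((node z 0).1 - P.q0) + multMu z (dy 0).1 + dn (P.initVel V z - P.v0)
    - ∑ k ∈ Finset.range (N + 1), P.DL V (node z k) (node z (k + 1)) (ctrl z k)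
        (dy k, dy (k + 1), du k)

/-- Both `φ` and `λ_N` act on the final velocity, and both `λ_0` and `ν` on the initial one, so the
varied velocities enter only through `endDefect` and `startDefect`. -/
theorem WellPosed.exists_hasFDerivAt_discreteObjective (hwp : P.WellPosed h D V) (hh : 0 < h)
    {z : DiscreteVars E U h (N + 1)} (hz : Admissible D z) :
    ∃ A : DiscreteVars E U h (N + 1) →L[ℝ] ℝ, HasFDerivAt (P.discreteObjective V) A z ∧
      ∀ x, A x = P.variation V z (node x) (ctrl x) (multMu x) (multNu x) := by
  have hseg : ∀ k, HasFDerivAt (fun x : DiscreteVars E U h (N + 1) => segData x k)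
      (((ContinuousLinearMap.fst ℝ E (Covec E)).comp (nodeCLM E U h (N + 1) k)).prod
        (((ContinuousLinearMap.fst ℝ E (Covec E)).comp (nodeCLM E U h (N + 1) (k + 1))).prod
          (ctrlCLM E U h (N + 1) k))) z := fun k =>
    (hasFDerivAt_node k z).fst.prodMk ((hasFDerivAt_node (k + 1) z).fst.prodMk
      (hasFDerivAt_ctrl k z))
  have hvf : HasFDerivAt (P.finalVel V) _ z :=
    (hwp.hasFDerivAt_velAt (hz N (by omega)) h).comp z (f := fun x => segData x N) (hseg N)
  have hvi : HasFDerivAt (P.initVel V) _ z :=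
    (hwp.hasFDerivAt_velAt (hz 0 (by omega)) 0).comp z (f := fun x => segData x 0) (hseg 0)
  have hqN : (node z (N + 1)).1 ∈ P.Q := by
    have hs := (hwp.stateSol_spec (hz N (by omega))).2
    have := (hs.1.2 h ⟨hh.le, le_rfl⟩).1
    rw [hs.2.2] at this
    exact this
  have hΦ : HasFDerivAt (fun x : E × E => P.phi x.1 x.2)
      (fderiv ℝ (fun x : E × E => P.phi x.1 x.2) ((node z (N + 1)).1, P.finalVel V z))
      ((node z (N + 1)).1, P.finalVel V z) :=
    ((P.contDiff_phi.contDiffAt (P.isOpen_prod_univ.mem_nhds ⟨hqN, mem_univ _⟩)).differentiableAt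
      one_ne_zero).hasFDerivAt
  have hΦ1 := hΦ.comp (node z (N + 1)).1 (f := fun x => (x, P.finalVel V z))
    (hasFDerivAt_prodMk_left _ _)
  have hΦ2 := hΦ.comp (P.finalVel V z) (f := fun x => ((node z (N + 1)).1, x))
    (hasFDerivAt_prodMk_right _ _)
  have h1 := hΦ.comp z (f := fun x => ((node x (N + 1)).1, P.finalVel V x))
    ((hasFDerivAt_node (N + 1) z).fst.prodMk hvf)
  have h2 := (hasFDerivAt_node (N + 1) z).snd.clm_apply hvf
  have h3 := (hasFDerivAt_node 0 z).snd.clm_apply hvi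
  have hmu : HasFDerivAt (multMu : DiscreteVars E U h (N + 1) → Covec E) _ z :=
    ((ContinuousLinearMap.fst ℝ (Covec E) (Covec E)).comp
      ((ContinuousLinearMap.snd ℝ (Fin (N + 1) → C1Curve h U) _).comp
        (.snd ℝ (Fin (N + 1 + 1) → E × Covec E) _))).hasFDerivAt
  have hnu : HasFDerivAt (multNu : DiscreteVars E U h (N + 1) → Covec E) _ z :=
    ((ContinuousLinearMap.snd ℝ (Covec E) (Covec E)).comp
      ((ContinuousLinearMap.snd ℝ (Fin (N + 1) → C1Curve h U) _).comp
        (.snd ℝ (Fin (N + 1 + 1) → E × Covec E) _))).hasFDerivAt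
  have h4 := hmu.clm_apply ((hasFDerivAt_node 0 z).fst.sub_const P.q0)
  have h5 := hnu.clm_apply (hvi.sub_const P.v0)
  have h6 : HasFDerivAt (fun x : DiscreteVars E U h (N + 1) => ∑ k ∈ Finset.range (N + 1),
      P.exactLagrangian V (node x k) (node x (k + 1)) (ctrl x k)) _ z :=
    HasFDerivAt.fun_sum (A' := fun k => (P.DL V (node z k) (node z (k + 1)) (ctrl z k)).comp
      ((nodeCLM E U h (N + 1) k).prod ((nodeCLM E U h (N + 1) (k + 1)).prod
        (ctrlCLM E U h (N + 1) k)))) fun k hk =>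
      (hwp.hasFDerivAt_exactLagrangian hh (hz k (Finset.mem_range.1 hk))).comp z
        (f := fun x => (node x k, node x (k + 1), ctrl x k))
        ((hasFDerivAt_node k z).prodMk ((hasFDerivAt_node (k + 1) z).prodMk (hasFDerivAt_ctrl k z)))
  refine ⟨_, ((((h1.add h2).sub h3).add h4).add h5).sub h6, fun x => ?_⟩
  have e1 : fderiv ℝ (fun x => P.phi x (P.finalVel V z)) (node z (N + 1)).1 = _ := hΦ1.fderiv
  have e2 : fderiv ℝ (P.phi (node z (N + 1)).1) (P.finalVel V z) = _ := hΦ2.fderiv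
  have e3 : ∀ (a b : E), fderiv ℝ (fun x : E × E => P.phi x.1 x.2)
      ((node z (N + 1)).1, P.finalVel V z) (a, b) =
      fderiv ℝ (fun x : E × E => P.phi x.1 x.2) ((node z (N + 1)).1, P.finalVel V z) (a, 0) +
      fderiv ℝ (fun x : E × E => P.phi x.1 x.2) ((node z (N + 1)).1, P.finalVel V z) (0, b) :=
    fun a b => by rw [← map_add]; simp
  simp only [variation, e1, e2, endDefect, startDefect]
  simp [multMu, multNu]
  rw [e3]
  ring

/-- Directions may be taken as arbitrary sequences on `ℕ`, since the variation reads only node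
indices up to `N + 1` and control indices up to `N`. This allows single-index test directions and
reindexing of sums. -/
theorem WellPosed.stationary_iff (hwp : P.WellPosed h D V) (hh : 0 < h)
    {z : DiscreteVars E U h (N + 1)} (hz : Admissible D z) :
    P.Stationary V z ↔ ∀ dy du dm dn, P.variation V z dy du dm dn = 0 := by
  obtain ⟨A, hA, hA'⟩ := hwp.exists_hasFDerivAt_discreteObjective hh hz
  constructor
  · intro H dy du dm dn
    have h0 : A = 0 := hA.unique H
    let x : DiscreteVars E U h (N + 1) := (fun i => dy i, fun i => du i, dm, dn)
    have hn : ∀ k ≤ N + 1, node x k = dy k := fun k hk => by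
      rw [node, dif_pos (by omega)]
    have hc : ∀ k ≤ N, ctrl x k = du k := fun k hk => by
      rw [ctrl, dif_pos (by omega)]
    have h1 : P.variation V z (node x) (ctrl x) dm dn = 0 := by
      refine (hA' x).symm.trans ?_
      rw [h0]
      rfl
    rw [← h1]
    unfold variation
    rw [hn 0 (by omega), hn 1 (by omega), hn N (by omega), hn (N + 1) le_rfl, hc N le_rfl,
      hc 0 (by omega)]
    congr 1
    refine Finset.sum_congr rfl fun k hk => ?_
    have := Finset.mem_range.1 hk
    rw [hn k (by omega), hn (k + 1) (by omega), hc k (by omega)]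
  · intro H
    have h0 : A = 0 := by
      refine ContinuousLinearMap.ext fun x => ?_
      rw [hA', H]
      rfl
    rwa [h0] at hA

end Objective

end ControlProblem

/-- Directions supported at one index isolate one coefficient each. There are `N + 3` intervals, so
the indices `0, 1, N + 2, N + 3` are distinct and `2, …, N + 1` are the ordinary inner nodes. At the
two extreme nodes only the `E` component is tested, as no `L` term occurs there. -/
theorem forall_linear_combination_eq_zero_iff {E L W : Type*} [NormedAddCommGroup E]
    [NormedSpace ℝ E] [NormedAddCommGroup L] [NormedSpace ℝ L]
    [NormedAddCommGroup W] [NormedSpace ℝ W]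
    {N : ℕ} (a₀ aN : E →L[ℝ] ℝ) (b₁ b₂ : E × L →L[ℝ] ℝ) (c : ℕ → E × L →L[ℝ] ℝ)
    (u₀ uN : W →L[ℝ] ℝ) (d : ℕ → W →L[ℝ] ℝ) (x y : E) :
    (∀ (dy : ℕ → E × L) (du : ℕ → W) (dm dn : E →L[ℝ] ℝ),
      a₀ (dy 0).1 + b₁ (dy 1) - ∑ k ∈ Finset.range N, c k (dy (k + 2)) + b₂ (dy (N + 2))
      + aN (dy (N + 3)).1 + u₀ (du 0) - ∑ k ∈ Finset.range (N + 1), d k (du (k + 1))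
      + uN (du (N + 2)) + dm x + dn y = 0) ↔
    a₀ = 0 ∧ b₁ = 0 ∧ (∀ k < N, c k = 0) ∧ b₂ = 0 ∧ aN = 0 ∧ u₀ = 0 ∧ (∀ k < N + 1, d k = 0) ∧
      uN = 0 ∧ x = 0 ∧ y = 0 := by
  constructor
  · intro H
    refine ⟨?_, ?_, fun k hk => ?_, ?_, ?_, ?_, fun k hk => ?_, ?_, ?_, ?_⟩
    · refine ContinuousLinearMap.ext fun w => ?_
      simpa [Pi.single_apply] using H (Pi.single 0 (w, 0)) 0 0 0
    · refine ContinuousLinearMap.ext fun w => ?_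
      simpa [Pi.single_apply] using H (Pi.single 1 w) 0 0 0
    · refine ContinuousLinearMap.ext fun w => ?_
      have h1 : N ≠ k := by omega
      have h2 : N + 3 ≠ k + 2 := by omega
      simpa [Pi.single_apply, apply_ite, hk, h1, h2] using H (Pi.single (k + 2) w) 0 0 0
    · refine ContinuousLinearMap.ext fun w => ?_
      have h1 : ∀ k ∈ Finset.range N, (c k) (if k = N then w else 0) = 0 := fun k hk => by
        rw [if_neg (Finset.mem_range.1 hk).ne, map_zero]
      simpa [Pi.single_apply, Finset.sum_eq_zero h1] using H (Pi.single (N + 2) w) 0 0 0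
    · refine ContinuousLinearMap.ext fun w => ?_
      have h1 : ∀ k ∈ Finset.range N, (c k) (if k = N + 1 then (w, 0) else 0) = 0 :=
        fun k hk => by
          have := Finset.mem_range.1 hk
          rw [if_neg (by omega), map_zero]
      simpa [Pi.single_apply, Finset.sum_eq_zero h1] using H (Pi.single (N + 3) (w, 0)) 0 0 0
    · refine ContinuousLinearMap.ext fun w => ?_
      simpa [Pi.single_apply] using H 0 (Pi.single 0 w) 0 0
    · refine ContinuousLinearMap.ext fun w => ?_
      have h1 : N + 2 ≠ k + 1 := by omega
      simpa [Pi.single_apply, apply_ite, hk, h1] using H 0 (Pi.single (k + 1) w) 0 0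
    · refine ContinuousLinearMap.ext fun w => ?_
      have h1 : ∀ k ∈ Finset.range (N + 1), (d k) (if k + 1 = N + 2 then w else 0) = 0 :=
        fun k hk => by
          have := Finset.mem_range.1 hk
          rw [if_neg (by omega), map_zero]
      have h2 := H 0 (Pi.single (N + 2) w) 0 0
      simp only [Pi.single_apply, Finset.sum_eq_zero h1] at h2
      simpa using h2
    -- The multiplier variations range over the whole dual, which separates points by Hahn-Banach.
    · exact SeparatingDual.eq_zero_of_forall_dual_eq_zero (R := ℝ) fun f => by simpa using H 0 0 f 0
    · exact SeparatingDual.eq_zero_of_forall_dual_eq_zero (R := ℝ) fun f => by simpa using H 0 0 0 f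
  · rintro ⟨rfl, rfl, hc, rfl, rfl, rfl, hd, rfl, rfl, rfl⟩ dy du dm dn
    rw [Finset.sum_eq_zero fun k hk => by rw [hc k (Finset.mem_range.1 hk)]; rfl,
      Finset.sum_eq_zero fun k hk => by rw [hd k (Finset.mem_range.1 hk)]; rfl]
    simp

/-! ### Discrete optimality conditions and their matching form. -/

namespace ControlProblem

variable {P : ControlProblem E U} {h : ℝ} {D : Set (E × E × C1Curve h U)} {V : Set (C1Curve h E)}
  {N : ℕ}

/-- The variation of the discrete objective sorted by the varied quantities. -/
theorem WellPosed.variation_eq (hwp : P.WellPosed h D V) (hh : 0 < h)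
    {z : DiscreteVars E U h (N + 2 + 1)} (hz : Admissible D z) (dy : ℕ → E × Covec E)
    (du : ℕ → C1Curve h U) (dm dn : Covec E) :
    P.variation V z dy du dm dn =
      ((startDefect z).comp
        (fderiv ℝ (fun a => P.velMinus V a (node z 1).1 (ctrl z 0)) (node z 0).1)
      + multMu z
      - fderiv ℝ (fun a => P.exactLagrangian V (a, (node z 0).2) (node z 1) (ctrl z 0))
          (node z 0).1) (dy 0).1
      + ((startDefect z).comp
        (fderiv ℝ (fun w : E × Covec E => P.velMinus V (node z 0).1 w.1 (ctrl z 0)) (node z 1))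
      - (P.D1L V (node z 1) (node z 2) (ctrl z 1)
          + P.D2L V (node z 0) (node z 1) (ctrl z 0))) (dy 1)
      - ∑ k ∈ Finset.range N, (P.D1L V (node z (k + 2)) (node z (k + 3)) (ctrl z (k + 2))
          + P.D2L V (node z (k + 1)) (node z (k + 2)) (ctrl z (k + 1))) (dy (k + 2))
      + ((P.endDefect V z).comp
        (fderiv ℝ (fun w : E × Covec E => P.velPlus V w.1 (node z (N + 3)).1 (ctrl z (N + 2)))
          (node z (N + 2)))
      - (P.D2L V (node z (N + 1)) (node z (N + 2)) (ctrl z (N + 1))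
          + P.D1L V (node z (N + 2)) (node z (N + 3)) (ctrl z (N + 2)))) (dy (N + 2))
      + ((P.endDefect V z).comp
        (fderiv ℝ (fun b => P.velPlus V (node z (N + 2)).1 b (ctrl z (N + 2))) (node z (N + 3)).1)
      + fderiv ℝ (fun x => P.phi x (P.finalVel V z)) (node z (N + 3)).1
      - fderiv ℝ (fun b => P.exactLagrangian V (node z (N + 2)) (b, (node z (N + 3)).2)
          (ctrl z (N + 2))) (node z (N + 3)).1) (dy (N + 3)).1
      + ((startDefect z).comp
        (fderiv ℝ (fun w => P.velMinus V (node z 0).1 (node z 1).1 w) (ctrl z 0))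
      - P.D3L V (node z 0) (node z 1) (ctrl z 0)) (du 0)
      - ∑ k ∈ Finset.range (N + 1),
          P.D3L V (node z (k + 1)) (node z (k + 2)) (ctrl z (k + 1)) (du (k + 1))
      + ((P.endDefect V z).comp
        (fderiv ℝ (fun w => P.velPlus V (node z (N + 2)).1 (node z (N + 3)).1 w) (ctrl z (N + 2)))
      - P.D3L V (node z (N + 2)) (node z (N + 3)) (ctrl z (N + 2))) (du (N + 2))
      + dm ((node z 0).1 - P.q0) + dn (P.initVel V z - P.v0) := by
  have h0 := hz 0 (by omega)
  have hN := hz (N + 2) (by omega)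
  have hDL : ∀ k ∈ Finset.range (N + 2 + 1),
      P.DL V (node z k) (node z (k + 1)) (ctrl z k) (dy k, dy (k + 1), du k) =
      P.D1L V (node z k) (node z (k + 1)) (ctrl z k) (dy k)
      + P.D2L V (node z k) (node z (k + 1)) (ctrl z k) (dy (k + 1))
      + P.D3L V (node z k) (node z (k + 1)) (ctrl z k) (du k) := fun k hk =>
    hwp.DL_eq_add hh (hz k (Finset.mem_range.1 hk)) _ _ _
  have hW : ∀ (s : ℝ) (d : E × E × C1Curve h U) (a b : E) (w : C1Curve h U),
      P.DVel V s d (a, b, w) = P.DVel V s d (a, 0, 0) + P.DVel V s d (0, b, 0)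
        + P.DVel V s d (0, 0, w) := fun s d a b w => by
    rw [← map_add, ← map_add]
    simp
  -- The `λ_0` part of `D₁` and, below, the `λ_N` part of `D₂` are end velocities; they cancel the
  -- corresponding terms of the objective.
  have e1 : P.D1L V (node z 0) (node z 1) (ctrl z 0) (dy 0) =
      P.D1L V (node z 0) (node z 1) (ctrl z 0) ((dy 0).1, 0) - (dy 0).2 (P.initVel V z) := by
    rw [hwp.D1L_apply hh h0, hwp.D1L_apply hh h0, hwp.DL_apply hh h0, hwp.DL_apply hh h0]
    simp [initVel]
    ring
  have e2 : P.D2L V (node z (N + 2)) (node z (N + 3)) (ctrl z (N + 2)) (dy (N + 3)) =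
      P.D2L V (node z (N + 2)) (node z (N + 3)) (ctrl z (N + 2)) ((dy (N + 3)).1, 0)
        + (dy (N + 3)).2 (P.finalVel V z) := by
    rw [hwp.D2L_apply hh hN, hwp.D2L_apply hh hN, hwp.DL_apply hh hN, hwp.DL_apply hh hN]
    simp [finalVel]
    ring
  have f1 := hwp.fderiv_velAt_left h0 0 (dy 0).1
  have f2 := hwp.fderiv_velAt_right_node h0 0 (node z 1).2 (dy 1)
  have f3 := hwp.fderiv_velAt_control h0 0 (du 0)
  have f4 := hwp.fderiv_velAt_left_node hN h (node z (N + 2)).2 (dy (N + 2))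
  have f5 := hwp.fderiv_velAt_right hN h (dy (N + 3)).1
  have f6 := hwp.fderiv_velAt_control hN h (du (N + 2))
  have f7 := hwp.fderiv_exactLagrangian_left_fst hh h0 (dy 0).1
  have f8 := hwp.fderiv_exactLagrangian_right_fst hh hN (dy (N + 3)).1
  unfold variation
  -- The exceptional indices are split off: nodes `0`, `1`, `N + 2` for `D₁`, nodes `1`, `N + 2`, `N
  -- + 3` for `D₂`, and the first and last control. The remaining node sums both run over `2, …, N +
  -- 1`.
  rw [Finset.sum_congr rfl hDL, Finset.sum_add_distrib, Finset.sum_add_distrib,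
    Finset.sum_range_succ (fun k => P.D1L V (node z k) (node z (k + 1)) (ctrl z k) (dy k)),
    Finset.sum_range_succ' (fun k => P.D1L V (node z k) (node z (k + 1)) (ctrl z k) (dy k)),
    Finset.sum_range_succ',
    Finset.sum_range_succ (fun k => P.D2L V (node z k) (node z (k + 1)) (ctrl z k) (dy (k + 1))),
    Finset.sum_range_succ (fun k => P.D2L V (node z k) (node z (k + 1)) (ctrl z k) (dy (k + 1))),
    Finset.sum_range_succ' (fun k => P.D2L V (node z k) (node z (k + 1)) (ctrl z k) (dy (k + 1))),
    Finset.sum_range_succ (fun k => P.D3L V (node z k) (node z (k + 1)) (ctrl z k) (du k)),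
    Finset.sum_range_succ' (fun k => P.D3L V (node z k) (node z (k + 1)) (ctrl z k) (du k)),
    hW h, hW 0]
  simp only [add_apply, sub_apply, ContinuousLinearMap.comp_apply, Finset.sum_add_distrib,
    zero_add, add_assoc, Nat.reduceAdd, map_add, velMinus, velPlus]
  simp only [Prod.mk.eta] at f1 f2 f3 f4 f5 f6 f7 f8
  simp only [segData, zero_add, add_assoc, Nat.reduceAdd] at f1 f2 f3 f4 f5 f6 f7 f8 ⊢
  rw [e1, e2, f1, f2, f3, f4, f5, f6, f7, f8]
  ring

theorem WellPosed.stationary_iff_discreteConditions (hwp : P.WellPosed h D V) (hh : 0 < h)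
    {z : DiscreteVars E U h (N + 2 + 1)} (hz : Admissible D z) :
    P.Stationary V z ↔ P.DiscreteConditions V z := by
  simp only [hwp.stationary_iff hh hz, hwp.variation_eq hh hz]
  rw [forall_linear_combination_eq_zero_iff]
  constructor
  · rintro ⟨h1, h2, h3, h4, h5, h6, h7, h8, h9, h10⟩
    refine ⟨fun k hk hk' => ?_, fun k hk hk' => ?_, h1, h2, h4, h5, h6, h8, sub_eq_zero.1 h9,
      sub_eq_zero.1 h10⟩
    · obtain ⟨k, rfl⟩ := Nat.exists_eq_add_of_le' hk
      exact h3 k (by omega)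
    · obtain ⟨k, rfl⟩ := Nat.exists_eq_add_of_le' hk
      exact h7 k (by omega)
  · rintro ⟨h3, h7, h1, h2, h4, h5, h6, h8, h9, h10⟩
    exact ⟨h1, h2, fun k hk => h3 (k + 2) (by omega) (by omega), h4, h5, h6,
      fun k hk => h7 (k + 1) (by omega) (by omega), h8, sub_eq_zero.2 h9, sub_eq_zero.2 h10⟩

/-- Under the appended equations, stationarity means that velocities and momenta match at the
inner nodes, the boundary conditions hold and the control equation holds. -/
theorem WellPosed.stationary_iff_matching (hwp : P.WellPosed h D V) (hh : 0 < h)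
    {z : DiscreteVars E U h (N + 1)} (hz : Admissible D z) (ha : P.Appended V z) :
    P.Stationary V z ↔
      (node z 0).1 = P.q0 ∧ P.initVel V z = P.v0 ∧
      multMu z = -P.segMomentum V (node z 0) (node z 1) (ctrl z 0) 0 ∧
      P.segMomentum V (node z N) (node z (N + 1)) (ctrl z N) h =
        fderiv ℝ (fun x => P.phi x (P.finalVel V z)) (node z (N + 1)).1 ∧
      (∀ k < N, P.segMomentum V (node z k) (node z (k + 1)) (ctrl z k) h =
        P.segMomentum V (node z (k + 1)) (node z (k + 2)) (ctrl z (k + 1)) 0) ∧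
      (∀ k < N, velAt (P.stateSol V (segData z k)) h = velAt (P.stateSol V (segData z (k + 1))) 0) ∧
      ∀ k < N + 1, ∀ s ∈ Icc 0 h,
        P.segResidual V (node z k) (node z (k + 1)) (ctrl z k) s = 0 := by
  -- The appended equations remove every derivative of an end velocity from the variation.
  have hs : startDefect z = 0 := by rw [startDefect, ha.1, sub_self]
  have he : P.endDefect V z = 0 := by rw [endDefect, ha.2, add_neg_cancel]
  have key : ∀ dy du dm dn, P.variation V z dy du dm dn =
      (fderiv ℝ (fun x => P.phi x (P.finalVel V z)) (node z (N + 1)).1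
        - P.segMomentum V (node z N) (node z (N + 1)) (ctrl z N) h) (dy (N + 1)).1
      + (multMu z + P.segMomentum V (node z 0) (node z 1) (ctrl z 0) 0) (dy 0).1
      + ∑ k ∈ Finset.range N,
        ((P.segMomentum V (node z (k + 1)) (node z (k + 2)) (ctrl z (k + 1)) 0
          - P.segMomentum V (node z k) (node z (k + 1)) (ctrl z k) h) (dy (k + 1)).1
        + (dy (k + 1)).2 (velAt (P.stateSol V (segData z (k + 1))) 0
          - velAt (P.stateSol V (segData z k)) h))
      - ∑ k ∈ Finset.range (N + 1), (∫ t in (0 : ℝ)..h,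
          P.segResidual V (node z k) (node z (k + 1)) (ctrl z k) t (posAt (du k) t))
      + dm ((node z 0).1 - P.q0) + dn (P.initVel V z - P.v0) := by
    intro dy du dm dn
    have hDL : ∀ k ∈ Finset.range (N + 1),
        P.DL V (node z k) (node z (k + 1)) (ctrl z k) (dy k, dy (k + 1), du k) =
        ((dy (k + 1)).2 (velAt (P.stateSol V (segData z k)) h)
          + P.segMomentum V (node z k) (node z (k + 1)) (ctrl z k) h (dy (k + 1)).1)
        - ((dy k).2 (velAt (P.stateSol V (segData z k)) 0)
          + P.segMomentum V (node z k) (node z (k + 1)) (ctrl z k) 0 (dy k).1)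
        + ∫ t in (0 : ℝ)..h,
          P.segResidual V (node z k) (node z (k + 1)) (ctrl z k) t (posAt (du k) t) :=
      fun k hk => by
        rw [hwp.DL_apply hh (hz k (Finset.mem_range.1 hk))]
        simp only [velPlus, velMinus, segData]
        ring
    unfold variation
    -- Discrete summation by parts: the last right-end term and the first left-end term are peeled
    -- off, and at each inner node the two adjacent segments leave a jump of momentum and a jump of
    -- velocity.
    rw [hs, he, Finset.sum_congr rfl hDL, Finset.sum_add_distrib, Finset.sum_sub_distrib,
      Finset.sum_range_succ (fun k => (dy (k + 1)).2 (velAt (P.stateSol V (segData z k)) h)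
          + P.segMomentum V (node z k) (node z (k + 1)) (ctrl z k) h (dy (k + 1)).1),
      Finset.sum_range_succ' (fun k => (dy k).2 (velAt (P.stateSol V (segData z k)) 0)
          + P.segMomentum V (node z k) (node z (k + 1)) (ctrl z k) 0 (dy k).1)]
    have ef : velAt (P.stateSol V (segData z N)) h = P.finalVel V z := rfl
    have ei : velAt (P.stateSol V (segData z 0)) 0 = P.initVel V z := rfl
    rw [ef, ei]
    simp only [add_apply, sub_apply, map_sub, Finset.sum_add_distrib, Finset.sum_sub_distrib,
      zero_apply, zero_add]
    ring
  rw [hwp.stationary_iff hh hz]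
  simp only [key]
  constructor
  · intro H
    refine ⟨sub_eq_zero.1 ?_, sub_eq_zero.1 ?_, eq_neg_of_add_eq_zero_left ?_,
      (sub_eq_zero.1 ?_).symm, fun k hk => (sub_eq_zero.1 ?_).symm,
      fun k hk => (sub_eq_zero.1 ?_).symm, fun k hk => ?_⟩
    · exact SeparatingDual.eq_zero_of_forall_dual_eq_zero (R := ℝ) fun f => by
        simpa using H 0 0 f 0
    · exact SeparatingDual.eq_zero_of_forall_dual_eq_zero (R := ℝ) fun f => by
        simpa using H 0 0 0 f
    · refine ContinuousLinearMap.ext fun w => ?_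
      simpa [Pi.single_apply] using H (Pi.single 0 (w, 0)) 0 0 0
    · refine ContinuousLinearMap.ext fun w => ?_
      have h1 := H (Pi.single (N + 1) (w, 0)) 0 0 0
      rw [Finset.sum_eq_zero fun k hk => by
        rw [Pi.single_eq_of_ne (by have := Finset.mem_range.1 hk; omega)]; simp] at h1
      simpa [Pi.single_apply] using h1
    · refine ContinuousLinearMap.ext fun w => ?_
      have h1 := H (Pi.single (k + 1) (w, 0)) 0 0 0
      rw [Finset.sum_eq_single_of_mem k (Finset.mem_range.2 hk) fun j _ hj => by
        rw [Pi.single_eq_of_ne (by omega)]; simp, Pi.single_eq_same,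
        Pi.single_eq_of_ne (by omega), Pi.single_eq_of_ne (by omega)] at h1
      simpa using h1
    · refine SeparatingDual.eq_zero_of_forall_dual_eq_zero (R := ℝ) fun f => ?_
      have h1 := H (Pi.single (k + 1) (0, f)) 0 0 0
      rw [Finset.sum_eq_single_of_mem k (Finset.mem_range.2 hk) fun j _ hj => by
        rw [Pi.single_eq_of_ne (by omega)]; simp, Pi.single_eq_same,
        Pi.single_eq_of_ne (by omega), Pi.single_eq_of_ne (by omega)] at h1
      simpa using h1
    -- Varying a single control gives a vanishing integral; the fundamental lemma makes the residual
    -- vanish at every point, including the end points.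
    · refine eqOn_zero_of_integral_apply_eq_zero hh (hwp.contDiffOn_segResidual hh (hz k hk))
        fun c => ?_
      have h1 := H 0 (Pi.single k c) 0 0
      rw [Finset.sum_eq_single_of_mem (s := Finset.range (N + 1)) k (Finset.mem_range.2 hk)
        fun j _ hj => by rw [Pi.single_eq_of_ne hj]; simp, Pi.single_eq_same] at h1
      simpa using h1
  · rintro ⟨h1, h2, h3, h4, h5, h6, h7⟩ dy du dm dn
    rw [h1, h2, h3, h4, Finset.sum_eq_zero fun k hk => by
        rw [h5 k (Finset.mem_range.1 hk), h6 k (Finset.mem_range.1 hk)]; simp,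
      Finset.sum_eq_zero fun k hk => ?_]
    · simp
    · rw [intervalIntegral.integral_congr (g := fun _ => (0 : ℝ)) fun s hs => ?_]
      · simp
      · rw [uIcc_of_le hh.le] at hs
        simp [h7 k (Finset.mem_range.1 hk) s hs]

variable {q v : ℝ → E} {l m : ℝ → Covec E} {u : ℝ → U}

/-! ### Restriction and gluing of the dynamics -/

theorem FirstOrderDynamics.congr {I : Set ℝ} {q' v' : ℝ → E} {l' m' : ℝ → Covec E} {u' : ℝ → U}
    (H : P.FirstOrderDynamics I q v l m u) (hq : EqOn q' q I) (hv : EqOn v' v I)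
    (hl : EqOn l' l I) (hm : EqOn m' m I) (hu : EqOn u' u I) :
    P.FirstOrderDynamics I q' v' l' m' u' where
  mem t ht := by rw [hq ht]; exact H.mem t ht
  deriv_q t ht := by rw [hv ht]; exact (H.deriv_q t ht).congr hq (hq ht)
  deriv_v t ht := by rw [hq ht, hv ht, hu ht]; exact (H.deriv_v t ht).congr hv (hv ht)
  deriv_l t ht := by rw [hm ht]; exact (H.deriv_l t ht).congr hl (hl ht)
  deriv_momentum t ht := by
    rw [hq ht, hv ht, hu ht, hl ht]
    exact (H.deriv_momentum t ht).congr (fun s hs => by rw [hq hs, hv hs, hl hs, hm hs])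
      (by rw [hq ht, hv ht, hl ht, hm ht])

theorem FirstOrderDynamics.comp_natCast_mul_add
    (H : P.FirstOrderDynamics (Icc 0 (N * h)) q v l m u) {k : ℕ} (hk : k < N) :
    P.FirstOrderDynamics (Icc 0 h) (fun s => q (k * h + s)) (fun s => v (k * h + s))
      (fun s => l (k * h + s)) (fun s => m (k * h + s)) (fun s => u (k * h + s)) where
  mem _ hs := H.mem _ (natCast_mul_add_mem_Icc hk hs)
  deriv_q _ hs := (H.deriv_q _ (natCast_mul_add_mem_Icc hk hs)).comp_natCast_mul_add hk
  deriv_v _ hs := (H.deriv_v _ (natCast_mul_add_mem_Icc hk hs)).comp_natCast_mul_add hk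
  deriv_l _ hs := (H.deriv_l _ (natCast_mul_add_mem_Icc hk hs)).comp_natCast_mul_add hk
  deriv_momentum _ hs :=
    (H.deriv_momentum _ (natCast_mul_add_mem_Icc hk hs)).comp_natCast_mul_add hk

/-- Every right-hand side is a function of the glued curves themselves, so the left and right
derivatives agree at the nodes. -/
theorem FirstOrderDynamics.of_comp_natCast_mul_add (hh : 0 ≤ h) (hN : 0 < N)
    (H : ∀ k < N, P.FirstOrderDynamics (Icc 0 h) (fun s => q (k * h + s)) (fun s => v (k * h + s))
      (fun s => l (k * h + s)) (fun s => m (k * h + s)) (fun s => u (k * h + s))) :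
    P.FirstOrderDynamics (Icc 0 (N * h)) q v l m u where
  mem t ht := by
    obtain ⟨k, hk, s, hs, rfl⟩ := exists_mem_Icc_natCast_mul_add_eq hN ht
    exact (H k hk).mem s hs
  deriv_q := hasDerivWithinAt_of_comp_natCast_mul_add hh hN fun k hk => (H k hk).deriv_q
  deriv_v := hasDerivWithinAt_of_comp_natCast_mul_add hh hN
    (x' := fun t => P.f (q t) (v t) + P.rho (q t) (u t)) fun k hk => (H k hk).deriv_v
  deriv_l := hasDerivWithinAt_of_comp_natCast_mul_add hh hN fun k hk => (H k hk).deriv_l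
  deriv_momentum := hasDerivWithinAt_of_comp_natCast_mul_add hh hN
    (x' := fun t => P.force (q t) (v t) (l t) (u t)) fun k hk => (H k hk).deriv_momentum

/-! ### From the continuous to the discrete conditions -/

/-- The segment curves of a sampled solution are its restrictions. -/
theorem WellPosed.sampling_eq (hwp : P.WellPosed h D V) (hh : 0 < h)
    {z : DiscreteVars E U h N} (hz : Admissible D z)
    (H : P.FirstOrderDynamics (Icc 0 (N * h)) q v l m u) (hm : ContinuousOn m (Icc 0 (N * h)))
    (hsamp : IsSampling V q l u z) {k : ℕ} (hk : k < N) {s : ℝ} (hs : s ∈ Icc 0 h) :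
    posAt (P.stateSol V (segData z k)) s = q (k * h + s) ∧
    velAt (P.stateSol V (segData z k)) s = v (k * h + s) ∧
    posAt (P.adjointSol V (segData z k) (node z k).2 (node z (k + 1)).2) s = l (k * h + s) ∧
    velAt (P.adjointSol V (segData z k) (node z k).2 (node z (k + 1)).2) s = m (k * h + s) := by
  have h0 : (0 : ℝ) ∈ Icc 0 h := ⟨le_rfl, hh.le⟩
  have h1 : h ∈ Icc 0 h := ⟨hh.le, le_rfl⟩
  have e1 : ((k + 1 : ℕ) : ℝ) * h = k * h + h := by push_cast; ring
  have Hk := H.comp_natCast_mul_add hk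
  obtain ⟨c, hcV, hc⟩ := hsamp.state_mem k hk
  -- The curve in `V` is known only to agree in position with `q`; uniqueness of derivatives
  -- identifies its velocity.
  have hcv : ∀ s ∈ Icc 0 h, velAt c s = v (k * h + s) := fun s hs =>
    (uniqueDiffOn_Icc hh s hs).eq_deriv _ (hasDerivWithinAt_posAt c hs)
      ((Hk.deriv_q s hs).congr hc (hc s hs))
  obtain ⟨lc, hlc⟩ := exists_posAt_velAt_eq
    (hm.comp (by fun_prop : Continuous fun s => k * h + s).continuousOn
      fun s hs => natCast_mul_add_mem_Icc hk hs) Hk.deriv_l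
  have Hk' : P.FirstOrderDynamics (Icc 0 h) (posAt c) (velAt c) (posAt lc) (velAt lc)
      (posAt (ctrl z k)) :=
    Hk.congr hc hcv (fun s hs => (hlc s hs).1) (fun s hs => (hlc s hs).2) (hsamp.controls k hk)
  have hw := contDiffOn_posAt hh (ctrl z k)
  have n0 := hsamp.nodes k hk.le
  have n1 := hsamp.nodes (k + 1) hk
  have hstate : P.stateSol V (segData z k) = c := by
    refine hwp.stateSol_eq (hz k hk) hcV ⟨Hk'.stateDynamics hh hw, ?_, ?_⟩
    · rw [hc 0 h0, segData, n0, add_zero]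
    · rw [hc h h1, segData, n1, e1]
  have hadj : P.adjointSol V (segData z k) (node z k).2 (node z (k + 1)).2 = lc := by
    refine hwp.adjointSol_eq (hz k hk) ⟨?_, ?_, ?_⟩
    · rw [hstate]
      exact Hk'.adjointDynamics hh hw (continuousOn_velAt lc)
    · rw [(hlc 0 h0).1, n0, add_zero]
    · rw [(hlc h h1).1, n1, e1]
  rw [hstate, hadj]
  exact ⟨hc s hs, hcv s hs, (hlc s hs).1, (hlc s hs).2⟩

theorem WellPosed.stationary_of_continuousConditions (hwp : P.WellPosed h D V) (hh : 0 < h)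
    {z : DiscreteVars E U h (N + 1)} (hz : Admissible D z)
    (hC : P.ContinuousConditions ((N + 1 : ℕ) * h) q l u (multMu z) (multNu z))
    (hsamp : IsSampling V q l u z) : P.Stationary V z ∧ P.Appended V z := by
  have hT : 0 < ((N + 1 : ℕ) : ℝ) * h := by positivity
  have hU := uniqueDiffOn_Icc hT
  set I := Icc 0 (((N + 1 : ℕ) : ℝ) * h) with hI
  have H : P.FirstOrderDynamics I q (derivWithin q I) l (derivWithin l I) u :=
    .of_dynamics hT
      (fun t ht => (hC.state.1.differentiableOn (by norm_num) t ht).hasDerivWithinAt)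
      (fun t ht => (hC.adjoint.1.differentiableOn (by norm_num) t ht).hasDerivWithinAt)
      hC.state hC.adjoint
  have hseg := fun k (hk : k < N + 1) s (hs : s ∈ Icc 0 h) => hwp.sampling_eq hh hz H
    (hC.adjoint.1.continuousOn_derivWithin hU (by norm_num)) hsamp hk hs
  have h0 : (0 : ℝ) ∈ Icc 0 h := ⟨le_rfl, hh.le⟩
  have h1 : h ∈ Icc 0 h := ⟨hh.le, le_rfl⟩
  have e1 : ∀ k : ℕ, (k : ℝ) * h + h = ((k + 1 : ℕ) : ℝ) * h := fun k => by push_cast; ring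
  have n0 : node z 0 = (q 0, l 0) := by simpa using hsamp.nodes 0 (by omega)
  have nN := hsamp.nodes (N + 1) le_rfl
  have hmom : ∀ k < N + 1, ∀ s ∈ Icc 0 h,
      P.segMomentum V (node z k) (node z (k + 1)) (ctrl z k) s =
        P.momentum (q (k * h + s)) (derivWithin q I (k * h + s)) (l (k * h + s))
          (derivWithin l I (k * h + s)) := fun k hk s hs => by
    obtain ⟨a1, a2, a3, a4⟩ := hseg k hk s hs
    rw [← a1, ← a2, ← a3, ← a4]
    rfl
  have hvi : P.initVel V z = derivWithin q I 0 := by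
    have := (hseg 0 (by omega) 0 h0).2.1
    rw [Nat.cast_zero, zero_mul, zero_add] at this
    exact this
  have hvf : P.finalVel V z = derivWithin q I ((N + 1 : ℕ) * h) := by
    rw [← e1]
    exact (hseg N (by omega) h h1).2.1
  have ha : P.Appended V z := by
    refine ⟨?_, ?_⟩
    · rw [n0, hC.transversality_nu]
    · rw [hvf, nN]
      exact hC.transversality_l
  refine ⟨(hwp.stationary_iff_matching hh hz ha).2 ⟨?_, ?_, ?_, ?_, ?_, ?_, ?_⟩, ha⟩
  · rw [n0]
    exact hC.initial_q
  · rw [hvi]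
    exact hC.initial_v
  · rw [hmom 0 (by omega) 0 h0, hC.transversality_mu]
    simp only [momentum, fv, Nat.cast_zero, zero_mul, add_zero]
    abel
  -- At `T` the two transversality conditions combine: in `λ̇ + (∂f/∂q̇)ᵀ λ` the terms containing
  -- `∂φ/∂q̇` cancel and `∂φ/∂q` remains.
  · rw [hmom N (by omega) h h1, e1, hvf, nN]
    simp only [momentum]
    rw [hC.transversality_dl, hC.transversality_l, ← hI]
    ext x
    simp [fv]
  · intro k hk
    rw [hmom k (by omega) h h1, hmom (k + 1) (by omega) 0 h0, e1, add_zero]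
  · intro k hk
    rw [(hseg k (by omega) h h1).2.1, (hseg (k + 1) (by omega) 0 h0).2.1, e1, add_zero]
  · intro k hk s hs
    have hmin := hC.minimisation _ (natCast_mul_add_mem_Icc hk hs)
    obtain ⟨a1, a2, a3, a4⟩ := hseg k hk s hs
    rw [← a1, ← a3, ← hsamp.controls k hk s hs] at hmin
    exact sub_eq_zero.2 hmin.symm

/-! ### From the discrete to the continuous conditions -/

/-- In finite dimension the injective map `g(q)` is an isomorphism onto the dual, so `u = g(q)⁻¹
ρ(q)ᵀ λ`; inversion is smooth at invertible operators. Thus `u` is `C¹` even across the nodes. -/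
theorem contDiffOn_control [FiniteDimensional ℝ U] {I : Set ℝ} (hQ : ∀ t ∈ I, q t ∈ P.Q)
    (hq : ContDiffOn ℝ 1 q I) (hl : ContDiffOn ℝ 1 l I)
    (hu : ∀ t ∈ I, P.g (q t) (u t) = (l t).comp (P.rho (q t))) : ContDiffOn ℝ 1 u I := by
  have : CompleteSpace U := FiniteDimensional.complete ℝ U
  have hfin : Module.finrank ℝ U = Module.finrank ℝ (Covec U) := by
    rw [← (LinearMap.toContinuousLinearMap (𝕜 := ℝ) (E := U) (F' := ℝ)).finrank_eq]
    exact (Subspace.dual_finrank_eq (K := ℝ) (V := U)).symm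
  have hinv : ∀ t ∈ I, ∃ e : U ≃L[ℝ] Covec U, (e : U →L[ℝ] Covec U) = P.g (q t) := fun t ht =>
    ⟨(LinearEquiv.ofInjectiveOfFinrankEq (P.g (q t)).toLinearMap (P.g_injective (hQ t ht))
      hfin).toContinuousLinearEquiv, by ext; rfl⟩
  have hg : ContDiffOn ℝ 1 (fun t => P.g (q t)) I := P.contDiffOn_g.comp hq hQ
  have hginv : ContDiffOn ℝ 1 (fun t => ContinuousLinearMap.inverse (P.g (q t))) I :=
    fun t ht => by
      obtain ⟨e, he⟩ := hinv t ht
      have h1 : ContDiffAt ℝ 1 ContinuousLinearMap.inverse (P.g (q t)) :=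
        he ▸ contDiffAt_map_inverse e
      exact h1.comp_contDiffWithinAt t (hg t ht)
  refine (hginv.clm_apply (hl.clm_comp (P.contDiff_rho.comp hq hQ))).congr fun t ht => ?_
  obtain ⟨e, he⟩ := hinv t ht
  have h1 := hu t ht
  rw [Function.comp_apply, ← h1, ← he, ContinuousLinearMap.inverse_equiv]
  simp

theorem WellPosed.continuousConditions_of_stationary [FiniteDimensional ℝ U]
    (hwp : P.WellPosed h D V) (hh : 0 < h) {z : DiscreteVars E U h (N + 1)} (hz : Admissible D z)
    (hst : P.Stationary V z) (ha : P.Appended V z) :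
    ∃ (q : ℝ → E) (l : ℝ → Covec E) (u : ℝ → U), P.IsConcatenation V z q l u ∧
      P.ContinuousConditions ((N + 1 : ℕ) * h) q l u (multMu z) (multNu z) := by
  obtain ⟨hq0, hv0, hmu, hpN, hp, hv, hr⟩ := (hwp.stationary_iff_matching hh hz ha).1 hst
  have h0 : (0 : ℝ) ∈ Icc 0 h := ⟨le_rfl, hh.le⟩
  have h1 : h ∈ Icc 0 h := ⟨hh.le, le_rfl⟩
  have e1 : ∀ k : ℕ, (k : ℝ) * h + h = ((k + 1 : ℕ) : ℝ) * h := fun k => by push_cast; ring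
  let c : ℕ → C1Curve h E := fun k => P.stateSol V (segData z k)
  let a : ℕ → C1Curve h (Covec E) := fun k =>
    P.adjointSol V (segData z k) (node z k).2 (node z (k + 1)).2
  have hc : ∀ k < N + 1, posAt (c k) 0 = (node z k).1 ∧ posAt (c k) h = (node z (k + 1)).1 :=
    fun k hk => (hwp.stateSol_spec (hz k hk)).2.2
  have hl : ∀ k < N + 1, posAt (a k) 0 = (node z k).2 ∧ posAt (a k) h = (node z (k + 1)).2 :=
    fun k hk => (hwp.adjointSol_spec (hz k hk) _ _).2
  have hF : ∀ k < N + 1, P.FirstOrderDynamics (Icc 0 h) (posAt (c k)) (velAt (c k)) (posAt (a k))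
      (velAt (a k)) (posAt (ctrl z k)) := fun k hk => hwp.firstOrderDynamics hh (hz k hk) _ _
  have mq : ∀ k, k + 1 < N + 1 → posAt (c k) h = posAt (c (k + 1)) 0 := fun k hk => by
    rw [(hc k (by omega)).2, (hc (k + 1) hk).1]
  have ml : ∀ k, k + 1 < N + 1 → posAt (a k) h = posAt (a (k + 1)) 0 := fun k hk => by
    rw [(hl k (by omega)).2, (hl (k + 1) hk).1]
  have mv : ∀ k, k + 1 < N + 1 → velAt (c k) h = velAt (c (k + 1)) 0 := fun k hk =>
    hv k (by omega)
  have mm : ∀ k, k + 1 < N + 1 → velAt (a k) h = velAt (a (k + 1)) 0 := fun k hk => by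
    have hpk : P.momentum (posAt (c k) h) (velAt (c k) h) (posAt (a k) h) (velAt (a k) h) =
        P.momentum (posAt (c (k + 1)) 0) (velAt (c (k + 1)) 0) (posAt (a (k + 1)) 0)
          (velAt (a (k + 1)) 0) := hp k (by omega)
    rw [mq k hk, ml k hk, mv k hk] at hpk
    -- Position, velocity and `λ` already match, so the terms `(∂f/∂q̇)ᵀ λ` of the two momenta
    -- coincide and matching momenta give matching `λ̇`.
    exact add_right_cancel hpk
  have hmin : ∀ k < N + 1, ∀ s ∈ Icc 0 h, P.g (posAt (c k) s) (posAt (ctrl z k) s) =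
      (posAt (a k) s).comp (P.rho (posAt (c k) s)) := fun k hk s hs =>
    (sub_eq_zero.1 (hr k hk s hs)).symm
  have mu : ∀ k, k + 1 < N + 1 → posAt (ctrl z k) h = posAt (ctrl z (k + 1)) 0 := fun k hk => by
    -- The control relation on both sides of the node has the same right-hand side, and `g` is
    -- injective there.
    have g1 := hmin k (by omega) h h1
    rw [mq k hk, ml k hk, ← hmin (k + 1) hk 0 h0] at g1
    exact P.g_injective ((hF (k + 1) hk).mem 0 h0) g1
  obtain ⟨q, hq⟩ := exists_concatenation (fun k => posAt (c k)) hh (N + 1) mq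
  obtain ⟨v, hv⟩ := exists_concatenation (fun k => velAt (c k)) hh (N + 1) mv
  obtain ⟨l, hl'⟩ := exists_concatenation (fun k => posAt (a k)) hh (N + 1) ml
  obtain ⟨m, hm⟩ := exists_concatenation (fun k => velAt (a k)) hh (N + 1) mm
  obtain ⟨u, hu⟩ := exists_concatenation (fun k => posAt (ctrl z k)) hh (N + 1) mu
  have hT : 0 < ((N + 1 : ℕ) : ℝ) * h := by positivity
  have hU := uniqueDiffOn_Icc hT
  have t0 : (0 : ℝ) ∈ Icc 0 (((N + 1 : ℕ) : ℝ) * h) := ⟨le_rfl, hT.le⟩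
  have tT : ((N + 1 : ℕ) : ℝ) * h ∈ Icc 0 (((N + 1 : ℕ) : ℝ) * h) := ⟨hT.le, le_rfl⟩
  have H : P.FirstOrderDynamics (Icc 0 ((N + 1 : ℕ) * h)) q v l m u :=
    .of_comp_natCast_mul_add hh.le (by omega) fun k hk =>
      (hF k hk).congr (hq k hk) (hv k hk) (hl' k hk) (hm k hk) (hu k hk)
  have hmc : ContinuousOn m (Icc 0 ((N + 1 : ℕ) * h)) :=
    continuousOn_of_comp_natCast_mul_add hh.le (by omega) fun k hk =>
      (continuousOn_velAt (a k)).congr (hm k hk)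
  have hminT : ∀ t ∈ Icc 0 (((N + 1 : ℕ) : ℝ) * h), P.g (q t) (u t) = (l t).comp (P.rho (q t)) :=
    fun t ht => by
      obtain ⟨k, hk, s, hs, rfl⟩ := exists_mem_Icc_natCast_mul_add_eq (by omega) ht
      rw [hq k hk s hs, hu k hk s hs, hl' k hk s hs]
      exact hmin k hk s hs
  -- At this stage `q` and `λ` are known to be only `C¹`, which suffices for the control; the higher
  -- regularity of `q` and `λ` is then derived from that of `u`.
  have hu1 : ContDiffOn ℝ 1 u (Icc 0 ((N + 1 : ℕ) * h)) :=
    contDiffOn_control H.mem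
      (contDiffOn_one_of_hasDerivWithinAt hT H.deriv_q
        fun t ht => (H.deriv_v t ht).continuousWithinAt)
      (contDiffOn_one_of_hasDerivWithinAt hT H.deriv_l hmc) hminT
  have dq : ∀ t ∈ Icc 0 (((N + 1 : ℕ) : ℝ) * h),
      derivWithin q (Icc 0 ((N + 1 : ℕ) * h)) t = v t := fun t ht =>
    (H.deriv_q t ht).derivWithin (hU t ht)
  have dl : ∀ t ∈ Icc 0 (((N + 1 : ℕ) : ℝ) * h),
      derivWithin l (Icc 0 ((N + 1 : ℕ) * h)) t = m t := fun t ht =>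
    (H.deriv_l t ht).derivWithin (hU t ht)
  have q0 : q 0 = posAt (c 0) 0 := by simpa using hq 0 (by omega) 0 h0
  have v0 : v 0 = velAt (c 0) 0 := by simpa using hv 0 (by omega) 0 h0
  have l0 : l 0 = posAt (a 0) 0 := by simpa using hl' 0 (by omega) 0 h0
  have m0 : m 0 = velAt (a 0) 0 := by simpa using hm 0 (by omega) 0 h0
  have qT : q ((N + 1 : ℕ) * h) = posAt (c N) h := by rw [← e1]; exact hq N (by omega) h h1
  have vT : v ((N + 1 : ℕ) * h) = velAt (c N) h := by rw [← e1]; exact hv N (by omega) h h1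
  have lT : l ((N + 1 : ℕ) * h) = posAt (a N) h := by rw [← e1]; exact hl' N (by omega) h h1
  have mT : m ((N + 1 : ℕ) * h) = velAt (a N) h := by rw [← e1]; exact hm N (by omega) h h1
  have hvf : P.finalVel V z = velAt (c N) h := rfl
  have hlT : l ((N + 1 : ℕ) * h) =
      -fderiv ℝ (P.phi (q ((N + 1 : ℕ) * h))) (v ((N + 1 : ℕ) * h)) := by
    rw [lT, qT, vT, (hl N (by omega)).2, (hc N (by omega)).2, ← hvf]
    exact ha.2
  refine ⟨q, l, u, fun k hk s hs => ⟨hq k hk s hs, hl' k hk s hs, hu k hk s hs⟩, hu1,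
    H.adjointDynamics hT hu1 hmc, H.stateDynamics hT hu1, hminT, ?_, ?_, ?_, ?_, ?_, ?_⟩
  · rw [dl 0 t0, dq 0 t0, q0, v0, l0, m0, hmu, ← neg_add']
    rfl
  · rw [l0, (hl 0 (by omega)).1, ha.1]
  · have hpT : P.momentum (q ((N + 1 : ℕ) * h)) (v ((N + 1 : ℕ) * h)) (l ((N + 1 : ℕ) * h))
        (m ((N + 1 : ℕ) * h)) =
        fderiv ℝ (fun x => P.phi x (v ((N + 1 : ℕ) * h))) (q ((N + 1 : ℕ) * h)) := by
      rw [qT, vT, lT, mT, (hc N (by omega)).2, ← hvf, ← hpN, ← (hc N (by omega)).2]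
      rfl
    -- The condition on `λ̇(T)` is the momentum condition `p(T) = ∂φ/∂q` after substituting `λ(T) =
    -- -∂φ/∂q̇`.
    rw [dl _ tT, dq _ tT, ← hpT, momentum, hlT]
    ext x
    simp [fv]
  · rw [dq _ tT]
    exact hlT
  · rw [q0, (hc 0 (by omega)).1, hq0]
  · rw [dq 0 t0, v0, ← hv0]
    rfl

end ControlProblem

end Problem

end

/-! ### Assembly of the four assertions. -/

theorem mainTheorem2 {E U : Type*} [NormedAddCommGroup E] [NormedSpace ℝ E]
    [FiniteDimensional ℝ E] [NormedAddCommGroup U] [NormedSpace ℝ U] [FiniteDimensional ℝ U]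
    (P : ControlProblem E U) (h T : ℝ) (N : ℕ) (hh : 0 < h) (hN : 1 ≤ N) (hT : N * h = T)
    (D : Set (E × E × C1Curve h U)) (V : Set (C1Curve h E)) (hwp : P.WellPosed h D V) :
    -- the velocities are the discrete momenta conjugate to the adjoint variables
    (∀ a b u, (a, b, u) ∈ D → ∀ la lb : Covec E,
      HasFDerivAt (fun l => P.exactLagrangian V (a, l) (b, lb) u)
        (-(ContinuousLinearMap.apply ℝ ℝ (P.velMinus V a b u))) la ∧
      HasFDerivAt (fun l => P.exactLagrangian V (a, la) (b, l) u)
        (ContinuousLinearMap.apply ℝ ℝ (P.velPlus V a b u)) lb) ∧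
    -- the list of discrete conditions is the stationarity of the objective
    (3 ≤ N → ∀ z : DiscreteVars E U h N, Admissible D z →
      (P.Stationary V z ↔ P.DiscreteConditions V z)) ∧
    -- continuous conditions imply discrete conditions
    (∀ (q : ℝ → E) (l : ℝ → Covec E) (u : ℝ → U) (z : DiscreteVars E U h N),
      P.ContinuousConditions T q l u (multMu z) (multNu z) →
      IsSampling V q l u z → Admissible D z →
      P.Stationary V z ∧ P.Appended V z) ∧
    -- discrete conditions imply continuous conditions
    (∀ z : DiscreteVars E U h N, Admissible D z → P.Stationary V z → P.Appended V z →
      ∃ (q : ℝ → E) (l : ℝ → Covec E) (u : ℝ → U),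
        P.IsConcatenation V z q l u ∧
        P.ContinuousConditions T q l u (multMu z) (multNu z)) := by
  refine ⟨fun a b u hd la lb => ⟨?_, ?_⟩, fun h3 z hz => ?_, fun q l u z hC hs hz => ?_,
    fun z hz hst ha => ?_⟩
  · exact hwp.hasFDerivAt_exactLagrangian_left_snd hh (y := (a, la)) (y' := (b, lb)) hd
  · exact hwp.hasFDerivAt_exactLagrangian_right_snd hh (y := (a, la)) (y' := (b, lb)) hd
  -- Writing `N = M + 3` makes `y_1` and `y_{N-1}` distinct and leaves `M` ordinary inner nodes.
  · obtain ⟨M, rfl⟩ : ∃ M, N = M + 2 + 1 := ⟨N - 3, by omega⟩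
    exact hwp.stationary_iff_discreteConditions hh hz
  · obtain ⟨M, rfl⟩ : ∃ M, N = M + 1 := ⟨N - 1, by omega⟩
    subst hT
    exact hwp.stationary_of_continuousConditions hh hz hC hs
  · obtain ⟨M, rfl⟩ : ∃ M, N = M + 1 := ⟨N - 1, by omega⟩
    subst hT
    exact hwp.continuousConditions_of_stationary hh hz hst ha
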